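/- Theorem 1.1. Let $n\ge 1$, let $m_1,\dots,m_{n-1}$ be odd positive integers, let $f_i\in C^1(\mathbb{R}_{\ge 0}\times\mathbb{R}^i;\mathbb{R})$, $i=1,\dots,n$, and $a_i\in C^1(\mathbb{R}_{\ge 0}\times\mathbb{R};\mathbb{R})$, $i=1,\dots,n-1$, and consider the system $$\dot x_i=f_i(t,x_1,\dots,x_i)+a_i(t,x_1)\,x_{i+1}^{m_i}\quad(1\le i\le n-1),\qquad \dot x_n=f_n(t,x_1,\dots,x_n),\qquad y=x_1,\tag{1}$$ with state $x\in\mathbb{R}^n$ and output $y\in\mathbb{R}$. Assume that (1) is forward complete, that is, for all $t_0\ge 0$ and $x_0\in\mathbb{R}^n$ the solution with $x(t_0)=x_0$ exists for all $t\ge t_0$, and that $|a_i(t,y)|>0$ for all $t\ge0$, $y\in\mathbb{R}$ and $i=1,\dots,n-1$. Then: (i) The switching observer design problem is solvable for (1) with respect to $\mathbb{R}^n$: for every $t_0\ge0$ there exist times $t_0=t_1<t_2<t_3<\cdots$ with $t_k\to\infty$, continuous maps $G_k:[t_{k-1},t_{k+1}]\times\mathbb{R}^n\times\mathbb{R}\to\mathbb{R}^n$,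 $k=1,2,\dots$, and a nonempty set $\bar M\subset\mathbb{R}^n$ such that, for every solution $x(\cdot)$ of (1) on $[t_0,\infty)$, with output $y(\cdot)=x_1(\cdot)$, and for every choice of initial values $\zeta_k\in\bar M$, the solution $z_k$ of $\dot z_k=G_k(t,z_k,y(t))$, $z_k(t_{k-1})=\zeta_k$, exists, uniquely, on all of $[t_{k-1},t_{k+1}]$ for each $k\ge1$, and the function $Z:[t_0,\infty)\to\mathbb{R}^n$ defined by $Z(t)=z_k(t)$ for $t\in[t_k,t_{k+1})$, $k\ge1$, satisfies $\lim_{t\to\infty}(x(t)-Z(t))=0$. (ii) For every $R>0$, the observer design problem is solvable for (1) with respect to the closed ball $B_R=\{x\in\mathbb{R}^n:|x|\le R\}$: for every $t_0\ge0$ there exist a continuous map $G:[t_0,\infty)\times\mathbb{R}^n\times\mathbb{R}\to\mathbb{R}^n$ and a nonempty set $\bar M\subset\mathbb{R}^n$ such that, for every solution $x(\cdot)$ of (1) on $[t_0,\infty)$ with $x(t_0)\in B_R$, with output $y(\cdot)=x_1(\cdot)$, and for every $z_0\in\bar M$, the solution $z$ of $\dot z=G(t,z,y(t))$, $z(t_0)=z_0$,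 exists, uniquely, for all $t\ge t_0$ and $\lim_{t\to\infty}(x(t)-z(t))=0$. -/

import Mathlib

open Set Filter Topology

/-- `z` is the trajectory of `ż = v(t, z)` on the time set `I` (an interval with left endpoint
`s`) with initial value `z(s) = z₀`: it is a solution on the whole of `I`, and every solution with
the same initial value on an initial segment `[s, T]` of `I` coincides with it there. -/
def IsTrajectory {E : Type*} [NormedAddCommGroup E] [NormedSpace ℝ E]
    (v : ℝ → E → E) (I : Set ℝ) (s : ℝ) (z₀ : E) (z : ℝ → E) : Prop :=
  IsIntegralCurveOn z v I ∧ z s = z₀ ∧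
    ∀ (T : ℝ) (w : ℝ → E), Icc s T ⊆ I → IsIntegralCurveOn w v (Icc s T) → w s = z₀ →
      EqOn w z (Icc s T)

/-- The time-varying system `ẋ = f(t, x)`, `t ≥ 0`, is forward complete: from every initial time
`t₀ ≥ 0` and every initial state `x₀` there is a solution defined for all `t ≥ t₀`. -/
def ForwardComplete {E : Type*} [NormedAddCommGroup E] [NormedSpace ℝ E]
    (f : ℝ → E → E) : Prop :=
  ∀ t₀ : ℝ, 0 ≤ t₀ → ∀ x₀ : E, ∃ x : ℝ → E, IsIntegralCurveOn x f (Ici t₀) ∧ x t₀ = x₀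

/-- The Observer Design Problem for `ẋ = f(t, x)`, `y = h(t, x)` is solvable with respect to the
set `M` of initial states: for every `t₀ ≥ 0` there are a continuous `G` on
`[t₀, ∞) × E × Y` and a nonempty set `Mbar` of initial states of the observer `ż = G(t, z, y)`
such that for every output `y(t) = h(t, x(t))` generated by a solution with `x(t₀) ∈ M`, and every
`z₀ ∈ Mbar`, the trajectory `z` of the observer from `z₀` exists on `[t₀, ∞)` and
`x(t) - z(t) → 0`. -/
def ODPSolvable {E Y : Type*} [NormedAddCommGroup E] [NormedSpace ℝ E] [TopologicalSpace Y]
    (f : ℝ → E → E) (h : ℝ → E → Y) (M : Set E) : Prop :=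
  ∀ t₀ : ℝ, 0 ≤ t₀ →
    ∃ (G : ℝ → E → Y → E) (Mbar : Set E),
      ContinuousOn (fun p : ℝ × E × Y => G p.1 p.2.1 p.2.2) (Ici t₀ ×ˢ univ) ∧
      Mbar.Nonempty ∧
      ∀ x : ℝ → E, IsIntegralCurveOn x f (Ici t₀) → x t₀ ∈ M →
        ∀ z₀ ∈ Mbar, ∃ z : ℝ → E,
          IsTrajectory (fun t w => G t w (h t (x t))) (Ici t₀) t₀ z₀ z ∧
          Tendsto (fun t => x t - z t) atTop (𝓝 0)

/-- The Switching Observer Design Problem for `ẋ = f(t, x)`, `y = h(t, x)` is solvable with respect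
to the set `M` of initial states. For every `t₀ ≥ 0` there are switching times
`t₀ = τ 0 = τ 1 < τ 2 < ⋯ → ∞`, continuous maps `G k` on `[τ (k-1), τ (k+1)] × E × Y`, `k ≥ 1`,
and a nonempty set `Mbar`, such that for every output `y(t) = h(t, x(t))` generated by a solution
with `x(t₀) ∈ M` and all initial values `ζ k ∈ Mbar` the trajectory `z k` of `ż = G k (t, z, y)`,
`z(τ (k-1)) = ζ k`, exists on the whole of `[τ (k-1), τ (k+1)]`, and the error `x - Z` tends to
zero, where `Z = z k` on `[τ k, τ (k+1))` for each `k ≥ 1`. -/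
def SODPSolvable {E Y : Type*} [NormedAddCommGroup E] [NormedSpace ℝ E] [TopologicalSpace Y]
    (f : ℝ → E → E) (h : ℝ → E → Y) (M : Set E) : Prop :=
  ∀ t₀ : ℝ, 0 ≤ t₀ →
    ∃ (τ : ℕ → ℝ) (G : ℕ → ℝ → E → Y → E) (Mbar : Set E),
      τ 0 = t₀ ∧ τ 1 = t₀ ∧ StrictMonoOn τ (Ici 1) ∧ Tendsto τ atTop atTop ∧
      (∀ k : ℕ, 1 ≤ k →
        ContinuousOn (fun p : ℝ × E × Y => G k p.1 p.2.1 p.2.2)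
          (Icc (τ (k - 1)) (τ (k + 1)) ×ˢ univ)) ∧
      Mbar.Nonempty ∧
      ∀ x : ℝ → E, IsIntegralCurveOn x f (Ici t₀) → x t₀ ∈ M →
        ∀ ζ : ℕ → E, (∀ k, ζ k ∈ Mbar) →
          ∃ (z : ℕ → ℝ → E) (Z : ℝ → E),
            (∀ k : ℕ, 1 ≤ k →
              IsTrajectory (fun t w => G k t w (h t (x t)))
                (Icc (τ (k - 1)) (τ (k + 1))) (τ (k - 1)) (ζ k) (z k)) ∧
            (∀ k : ℕ, 1 ≤ k → EqOn Z (z k) (Ico (τ k) (τ (k + 1)))) ∧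
            Tendsto (fun t => x t - Z t) atTop (𝓝 0)

/-- The right-hand side of the triangular system of dimension `n + 1`. With indices counted
from `0`, its `i`-th component is `f i (t, x₀, …, xᵢ) + a i (t, x₀) * xᵢ₊₁ ^ m i` for `i < n`, and
`f n (t, x₀, …, xₙ)` for `i = n`. -/
def triangularField {n : ℕ} (f : (i : Fin (n + 1)) → ℝ → (Fin (i + 1) → ℝ) → ℝ)
    (a : Fin n → ℝ → ℝ → ℝ) (m : Fin n → ℕ) (t : ℝ) (x : EuclideanSpace ℝ (Fin (n + 1))) :
    EuclideanSpace ℝ (Fin (n + 1)) :=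
  WithLp.toLp 2 fun i =>
    f i t (fun j => x (Fin.castLE i.isLt j)) +
      if hi : (i : ℕ) < n then a ⟨i, hi⟩ t (x 0) * x (Fin.succ ⟨i, hi⟩) ^ m ⟨i, hi⟩ else 0

/-! The observer is a saturated copy of the system with a time-varying high gain. Forward
completeness and compactness bound all solutions from a given ball by one continuous function `β t`
(`ForwardComplete.exists_bound`). Cutting the observer's nonlinearities off outside `[-β, β]`
therefore changes nothing along these solutions, yet makes the observer globally Lipschitz in its
state, so that it has a unique global trajectory for every continuous output.

Let `e` be the error and `κ j = σ j * θ ^ k j`, where `σ j` is the constant sign of `a j`. The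
Lyapunov function weighs `e 0` and the links `e (j+1) - κ j * e j` by powers of a scale `θ t`. The
gains satisfy `L (j+1) = κ j * L j`, so the injection drops out of every link and only damps `e 0`.
The superdiagonal term of component `j`, entering link `j` through `-κ j`, damps `e (j+1)`: an odd
power is increasing, hence coercive up to an error `ξ`, although its derivative may vanish
(`le_clampPow_sub_mul`, `coercive_superdiagonal`). All other terms are of lower order in `θ`
(`GainExponents.lyapDeriv_le`).

The scale has to dominate constants that grow arbitrarily fast in time while its own derivative
stays harmless; `exists_scale` provides `|θ'| ≤ θ ^ 2`. The outcome is `V' ≤ -V + 1 / θ` with `θ ≥ t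
+ 2`, so the error tends to zero uniformly over the ball (`exists_observer`). This settles the
problem on balls. For arbitrary initial states, the `k`-th observer is designed for the ball of
radius `k` and comes into use only after a warm-up that makes its error at most `1 / (k + 1)`; every
solution belongs to all but finitely many of these balls. -/

/-! ### Global Lipschitz flows and bounds on reachable sets -/

theorem IsIntegralCurveOn.union_Icc {E : Type*} [NormedAddCommGroup E] [NormedSpace ℝ E]
    {v : ℝ → E → E} {γ₁ γ₂ : ℝ → E} {a b c : ℝ} (hab : a ≤ b) (hbc : b ≤ c)
    (h₁ : IsIntegralCurveOn γ₁ v (Icc a b)) (h₂ : IsIntegralCurveOn γ₂ v (Icc b c))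
    (h : γ₁ b = γ₂ b) :
    ∃ γ : ℝ → E, IsIntegralCurveOn γ v (Icc a c) ∧ γ a = γ₁ a := by
  classical
  let γ : ℝ → E := fun t => if t ≤ b then γ₁ t else γ₂ t
  have e₁ : EqOn γ γ₁ (Icc a b) := fun t ht => if_pos ht.2
  have e₂ : EqOn γ γ₂ (Icc b c) := fun t ht => by
    rcases ht.1.eq_or_lt with rfl | hlt
    · simp [γ, h]
    · exact if_neg (not_le.2 hlt)
  refine ⟨γ, fun t ht => ?_, e₁ ⟨le_rfl, hab⟩⟩
  rw [← Icc_union_Icc_eq_Icc hab hbc]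
  apply HasDerivWithinAt.union
  · by_cases htb : t ≤ b
    · have := (h₁ t ⟨ht.1, htb⟩).congr (fun y hy => e₁ hy) (e₁ ⟨ht.1, htb⟩)
      rwa [← e₁ ⟨ht.1, htb⟩] at this
    · apply HasFDerivWithinAt.of_notMem_closure
      rw [isClosed_Icc.closure_eq]
      exact fun h => htb h.2
  · by_cases htb : b ≤ t
    · have := (h₂ t ⟨htb, ht.2⟩).congr (fun y hy => e₂ hy) (e₂ ⟨htb, ht.2⟩)
      rwa [← e₂ ⟨htb, ht.2⟩] at this
    · apply HasFDerivWithinAt.of_notMem_closure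
      rw [isClosed_Icc.closure_eq]
      exact fun h => htb h.1

theorem exists_isIntegralCurveOn_Icc_of_lipschitz {E : Type*} [NormedAddCommGroup E]
    [NormedSpace ℝ E] [CompleteSpace E] {v : ℝ → E → E} {s T : ℝ}
    (hc : ∀ z, ContinuousOn (fun t => v t z) (Icc s T)) {K : NNReal}
    (hK : ∀ t ∈ Icc s T, LipschitzWith K (v t)) (hsT : s ≤ T) (z₀ : E) :
    ∃ z : ℝ → E, IsIntegralCurveOn z v (Icc s T) ∧ z s = z₀ := by
  obtain ⟨M, hM⟩ := isCompact_Icc.exists_bound_of_continuousOn (hc 0)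
  have hM0 : 0 ≤ M := (norm_nonneg _).trans (hM s ⟨le_rfl, hsT⟩)
  -- A step length depending on `K` alone: since `K * h ≤ 1 / 2`, the Picard–Lindelöf ball of radius
  -- `A` below is always large enough, whatever the initial state, and finitely many equal steps
  -- cover `[s, T]`.
  set h : ℝ := 1 / (2 * (K + 1)) with hh
  have hKn : (0 : ℝ) ≤ K := K.2
  have hpos : 0 < h := by positivity
  have hKh : K * h ≤ 1 / 2 := by
    rw [hh]; field_simp; linarith
  have step : ∀ a b, s ≤ a → a ≤ b → b ≤ T → b - a ≤ h → ∀ x₀ : E,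
      ∃ z : ℝ → E, IsIntegralCurveOn z v (Icc a b) ∧ z a = x₀ := by
    intro a b hsa hab hbT hbah x₀
    set A : ℝ := 2 * (M + K * ‖x₀‖) * h with hA
    have hA0 : 0 ≤ A := by positivity
    have hL0 : 0 ≤ M + K * (‖x₀‖ + A) := by positivity
    have pl : IsPicardLindelof v (tmin := a) (tmax := b) ⟨a, le_rfl, hab⟩ x₀ ⟨A, hA0⟩ 0
        ⟨M + K * (‖x₀‖ + A), hL0⟩ K := by
      refine ⟨fun t ht => (hK t ⟨hsa.trans ht.1, ht.2.trans hbT⟩).lipschitzOnWith,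
        fun x _ => (hc x).mono (Icc_subset_Icc hsa hbT), fun t ht x hx => ?_, ?_⟩
      · have htT : t ∈ Icc s T := ⟨hsa.trans ht.1, ht.2.trans hbT⟩
        have h1 := (hK t htT).dist_le_mul x 0
        rw [dist_eq_norm, dist_zero_right] at h1
        have h2 : ‖x‖ ≤ ‖x₀‖ + A := by
          have : ‖x - x₀‖ ≤ A := (dist_eq_norm x x₀).symm.trans_le hx
          calc ‖x‖ = ‖x₀ + (x - x₀)‖ := by congr 1; abel
            _ ≤ _ := (norm_add_le _ _).trans (by linarith)
        calc ‖v t x‖ = ‖v t 0 + (v t x - v t 0)‖ := by congr 1; abel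
          _ ≤ ‖v t 0‖ + ‖v t x - v t 0‖ := norm_add_le _ _
          _ ≤ M + K * ‖x‖ := add_le_add (hM t htT) h1
          _ ≤ M + K * (‖x₀‖ + A) := by gcongr
      · have : (max (b - a) (a - a)) = b - a := by simp [hab]
        simp only [this, NNReal.coe_zero, sub_zero]
        calc (M + K * (‖x₀‖ + A)) * (b - a) ≤ (M + K * (‖x₀‖ + A)) * h := by gcongr
          _ = A / 2 + (K * h) * A := by rw [hA]; ring
          _ ≤ A / 2 + (1 / 2) * A := by gcongr
          _ = A := by ring
    obtain ⟨z, hz0, hz⟩ := pl.exists_eq_forall_mem_Icc_hasDerivWithinAt₀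
    exact ⟨z, hz, hz0⟩
  have main : ∀ N : ℕ, ∀ b, s ≤ b → b ≤ T → b - s ≤ N * h →
      ∃ z : ℝ → E, IsIntegralCurveOn z v (Icc s b) ∧ z s = z₀ := by
    intro N
    induction N with
    | zero =>
      intro b hsb hbT hb
      exact step s b le_rfl hsb hbT (by simp at hb; linarith) z₀
    | succ N ih =>
      intro b hsb hbT hb
      push_cast at hb
      by_cases hcase : b - s ≤ h
      · exact step s b le_rfl hsb hbT hcase z₀
      · push Not at hcase
        obtain ⟨z₁, h₁, h₁s⟩ := ih (b - h) (by linarith) (by linarith) (by linarith)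
        obtain ⟨z₂, h₂, h₂s⟩ := step (b - h) b (by linarith) (by linarith) hbT (by linarith)
          (z₁ (b - h))
        obtain ⟨z, hz, hzs⟩ := h₁.union_Icc (by linarith) (by linarith) h₂ h₂s.symm
        exact ⟨z, hz, hzs.trans h₁s⟩
  obtain ⟨N, hN⟩ := exists_nat_ge ((T - s) / h)
  exact main N T hsT le_rfl ((div_le_iff₀ hpos).1 hN)

theorem IsIntegralCurveOn.hasDerivWithinAt_Ici {E : Type*} [NormedAddCommGroup E]
    [NormedSpace ℝ E] {v : ℝ → E → E} {γ : ℝ → E} {a b t : ℝ}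
    (h : IsIntegralCurveOn γ v (Icc a b)) (ht : t ∈ Ico a b) :
    HasDerivWithinAt γ (v t (γ t)) (Ici t) t :=
  ((h t ⟨ht.1, ht.2.le⟩).mono (Icc_subset_Icc_left ht.1)).mono_of_mem_nhdsWithin
    (Icc_mem_nhdsGE ht.2)

theorem IsIntegralCurveOn.eqOn_Icc_of_lipschitz {E : Type*} [NormedAddCommGroup E]
    [NormedSpace ℝ E] {v : ℝ → E → E} {s T : ℝ} {K : NNReal}
    (hK : ∀ t ∈ Icc s T, LipschitzWith K (v t)) {z w : ℝ → E}
    (hz : IsIntegralCurveOn z v (Icc s T)) (hw : IsIntegralCurveOn w v (Icc s T))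
    (h : z s = w s) : EqOn z w (Icc s T) := by
  intro t ht
  have := dist_le_of_trajectories_ODE_of_mem (K := K) (s := fun _ => univ) (δ := 0)
    (fun t ht => (hK t ⟨ht.1, ht.2.le⟩).lipschitzOnWith) hz.continuousOn
    (fun t ht => hz.hasDerivWithinAt_Ici ht) (fun _ _ => trivial) hw.continuousOn
    (fun t ht => hw.hasDerivWithinAt_Ici ht) (fun _ _ => trivial) (by simp [h]) t ht
  exact dist_le_zero.1 (by simpa using this)

/-- A vector field that is continuous in time and Lipschitz in the state, locally uniformly in
time, has a unique global forward trajectory from every initial state. -/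
theorem exists_isTrajectory_Ici_of_lipschitz {E : Type*} [NormedAddCommGroup E]
    [NormedSpace ℝ E] [CompleteSpace E] {v : ℝ → E → E} {s : ℝ}
    (hc : ∀ z, ContinuousOn (fun t => v t z) (Ici s))
    (hK : ∀ T, ∃ K : NNReal, ∀ t ∈ Icc s T, LipschitzWith K (v t)) (z₀ : E) :
    ∃ z : ℝ → E, IsTrajectory v (Ici s) s z₀ z := by
  have ex : ∀ N : ℕ, ∃ z : ℝ → E, IsIntegralCurveOn z v (Icc s (s + N)) ∧ z s = z₀ := by
    intro N
    obtain ⟨K, hK⟩ := hK (s + N)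
    exact exists_isIntegralCurveOn_Icc_of_lipschitz
      (fun z => (hc z).mono Icc_subset_Ici_self) hK (by simp) z₀
  choose z hz hzs using ex
  have uniq : ∀ (w₁ w₂ : ℝ → E) (T : ℝ), IsIntegralCurveOn w₁ v (Icc s T) →
      IsIntegralCurveOn w₂ v (Icc s T) → w₁ s = w₂ s → EqOn w₁ w₂ (Icc s T) := by
    intro w₁ w₂ T h₁ h₂ h
    obtain ⟨K, hK⟩ := hK T
    exact h₁.eqOn_Icc_of_lipschitz hK h₂ h
  -- The solutions on `[s, s + N]` agree by uniqueness; at time `t` the first one that reaches `t`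
  -- is read off.
  let Z : ℝ → E := fun t => z (⌈t - s⌉₊) t
  have hZ : ∀ N : ℕ, EqOn Z (z N) (Icc s (s + N)) := by
    intro N t ht
    have h1 : t ≤ s + ⌈t - s⌉₊ := by linarith [Nat.le_ceil (t - s)]
    refine uniq (z ⌈t - s⌉₊) (z N) t ((hz _).mono (Icc_subset_Icc_right h1))
      ((hz _).mono (Icc_subset_Icc_right ht.2)) ((hzs _).trans (hzs _).symm) ⟨ht.1, le_rfl⟩
  have hZs : Z s = z₀ := (hZ 0 (by simp)).trans (hzs 0)
  have hZi : IsIntegralCurveOn Z v (Ici s) := by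
    intro t ht
    obtain ⟨N, hN⟩ := exists_nat_gt (t - s)
    have htN : t ∈ Icc s (s + N) := ⟨ht, by linarith⟩
    have h1 := (hz N t htN).congr (fun y hy => hZ N hy) (hZ N htN)
    rw [← hZ N htN] at h1
    refine h1.mono_of_mem_nhdsWithin ?_
    rw [← Ici_inter_Iic]
    exact inter_mem_nhdsWithin _ (Iic_mem_nhds (by linarith))
  refine ⟨Z, hZi, hZs, fun T w _ hw hws => ?_⟩
  exact uniq w Z T hw (hZi.mono Icc_subset_Ici_self) (hws.trans hZs.symm)

theorem IsTrajectory.mono_Icc {E : Type*} [NormedAddCommGroup E] [NormedSpace ℝ E]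
    {v : ℝ → E → E} {s b : ℝ} {z₀ : E} {z : ℝ → E} (h : IsTrajectory v (Ici s) s z₀ z) :
    IsTrajectory v (Icc s b) s z₀ z :=
  ⟨h.1.mono Icc_subset_Ici_self, h.2.1, fun T w _ hw hws => h.2.2 T w Icc_subset_Ici_self hw hws⟩

/-- Solutions that start in a neighbourhood of a given initial state stay within distance one of
the given solution on a compact time interval. -/
theorem IsIntegralCurveOn.exists_forall_dist_le {E : Type*} [NormedAddCommGroup E]
    [NormedSpace ℝ E] {v : ℝ → E → E} {s T : ℝ} {x : ℝ → E}
    (hx : IsIntegralCurveOn x v (Icc s T))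
    (hv : ∀ r : ℝ, ∃ K : NNReal, ∀ t ∈ Icc s T, LipschitzOnWith K (v t) (Metric.closedBall 0 r)) :
    ∃ δ > 0, ∀ w : ℝ → E, IsIntegralCurveOn w v (Icc s T) → dist (x s) (w s) ≤ δ →
      ∀ t ∈ Icc s T, dist (x t) (w t) ≤ 1 := by
  obtain ⟨M, hM⟩ := isCompact_Icc.exists_bound_of_continuousOn hx.continuousOn
  obtain ⟨K, hK⟩ := hv (M + 1)
  refine ⟨Real.exp (-(K * (T - s))) / 2, by positivity, fun w hw hd => ?_⟩
  have hxw : ContinuousOn (fun t => dist (x t) (w t)) (Icc s T) :=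
    continuous_dist.comp_continuousOn (hx.continuousOn.prodMk hw.continuousOn)
  by_cases hsT : s ≤ T
  swap
  · intro t ht; exact absurd (ht.1.trans ht.2) hsT
  -- Bootstrap: distance at most `1` before `t` keeps `w` in the ball where `K` is a Lipschitz
  -- constant, and Grönwall with the chosen `δ` improves the bound to `1 / 2` at `t`. Continuous
  -- induction then covers `[s, T]`.
  have key : ∀ t ∈ Icc s T, (∀ r ∈ Ico s t, dist (x r) (w r) ≤ 1) → dist (x t) (w t) ≤ 1 / 2 := by
    intro t ht hr
    have hsub : Icc s t ⊆ Icc s T := Icc_subset_Icc_right ht.2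
    have := dist_le_of_trajectories_ODE_of_mem (K := K) (s := fun _ => Metric.closedBall 0 (M + 1))
      (fun r hr => hK r (hsub ⟨hr.1, hr.2.le⟩)) (hx.mono hsub).continuousOn
      (fun r hr => (hx.mono hsub).hasDerivWithinAt_Ici hr)
      (fun r hr => by
        simp only [Metric.mem_closedBall, dist_zero_right]
        linarith [hM r (hsub ⟨hr.1, hr.2.le⟩)]) (hw.mono hsub).continuousOn
      (fun r hr => (hw.mono hsub).hasDerivWithinAt_Ici hr)
      (fun r h => by
        have h1 := hM r (hsub ⟨h.1, h.2.le⟩)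
        have h2 := hr r h
        rw [Metric.mem_closedBall, dist_zero_right]
        calc ‖w r‖ = ‖x r - (x r - w r)‖ := by congr 1; abel
          _ ≤ ‖x r‖ + ‖x r - w r‖ := norm_sub_le _ _
          _ ≤ M + 1 := by rw [← dist_eq_norm]; linarith) hd t ⟨ht.1, le_rfl⟩
    refine this.trans ?_
    calc Real.exp (-(K * (T - s))) / 2 * Real.exp (K * (t - s))
        ≤ Real.exp (-(K * (T - s))) / 2 * Real.exp (K * (T - s)) := by
          gcongr; exact ht.2
      _ = 1 / 2 := by
          rw [div_mul_eq_mul_div, ← Real.exp_add]; simp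
  have hsub : Icc s T ⊆ {t | ∀ r ∈ Icc s t, dist (x r) (w r) ≤ 1 / 2} := by
    have hcl : IsClosed ({t | ∀ r ∈ Icc s t, dist (x r) (w r) ≤ 1 / 2} ∩ Icc s T) := by
      refine isClosed_of_closure_subset fun t ht => ?_
      have htI : t ∈ Icc s T := closure_minimal inter_subset_right isClosed_Icc ht
      refine ⟨?_, htI⟩
      have hlt : ∀ r ∈ Ico s t, dist (x r) (w r) ≤ 1 / 2 := by
        intro r hr
        obtain ⟨t', ht', hrt'⟩ := mem_closure_iff_nhds.1 ht (Ioi r) (Ioi_mem_nhds hr.2)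
        exact hrt'.1 r ⟨hr.1, le_of_lt ht'⟩
      intro r hr
      rcases hr.2.eq_or_lt with rfl | h
      · exact key _ htI fun q hq => (hlt q hq).trans (by norm_num)
      · exact hlt r ⟨hr.1, h⟩
    refine hcl.Icc_subset_of_forall_exists_gt ?_ ?_
    · intro r hr
      have : r = s := le_antisymm hr.2 hr.1
      subst this
      exact key _ ⟨le_rfl, hsT⟩ (by simp)
    · rintro t ⟨ht, htI⟩ y hy
      have h1 : dist (x t) (w t) < 1 := (ht t ⟨htI.1, le_rfl⟩).trans_lt (by norm_num)
      have h2 : ∀ᶠ r in 𝓝[≥] t, dist (x r) (w r) < 1 := by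
        have := (hxw t ⟨htI.1, htI.2.le⟩).eventually (eventually_lt_nhds h1)
        refine Filter.Eventually.filter_mono ?_ this
        have h3 : Icc t T ∈ 𝓝[≥] t := Icc_mem_nhdsGE htI.2
        exact nhdsWithin_le_iff.2 (mem_of_superset h3 (Icc_subset_Icc_left htI.1))
      obtain ⟨u, hu, hut⟩ := (mem_nhdsGE_iff_exists_Ico_subset' (show t < min y T from lt_min hy htI.2)).1
        h2
      refine ⟨min ((t + u) / 2) (min y T), ?_, ?_, ?_⟩
      · intro r hr
        have hrT : r ≤ T := hr.2.trans ((min_le_right _ _).trans (min_le_right _ _))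
        refine key r ⟨hr.1, hrT⟩ fun q hq => ?_
        rcases le_total q t with h | h
        · exact (ht q ⟨hq.1, h⟩).trans (by norm_num)
        · refine le_of_lt (hut ⟨h, ?_⟩)
          have := hr.2.trans (min_le_left _ _)
          have h3 := hu
          simp only [mem_Ioi] at h3
          linarith [hq.2]
      · have h3 := hu
        simp only [mem_Ioi] at h3
        exact lt_min (by linarith) (lt_min hy htI.2)
      · exact (min_le_right _ _).trans (min_le_left _ _)
  intro t ht
  exact (hsub ht t ⟨ht.1, le_rfl⟩).trans (by norm_num)

/-- The states reached by a forward complete, locally Lipschitz system in bounded time from a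
compact set of initial states form a bounded set. -/
theorem ForwardComplete.exists_bound {E : Type*} [NormedAddCommGroup E] [NormedSpace ℝ E]
    {v : ℝ → E → E} (hfc : ForwardComplete v)
    (hv : ∀ T r : ℝ, ∃ K : NNReal, ∀ t ∈ Icc 0 T,
      LipschitzOnWith K (v t) (Metric.closedBall 0 r))
    {t₀ : ℝ} (ht₀ : 0 ≤ t₀) {M : Set E} (hM : IsCompact M) (T : ℝ) :
    ∃ B : ℝ, ∀ x : ℝ → E, IsIntegralCurveOn x v (Ici t₀) → x t₀ ∈ M →
      ∀ t ∈ Icc t₀ T, ‖x t‖ ≤ B := by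
  refine hM.induction_on (p := fun S => ∃ B : ℝ, ∀ x : ℝ → E, IsIntegralCurveOn x v (Ici t₀) →
    x t₀ ∈ S → ∀ t ∈ Icc t₀ T, ‖x t‖ ≤ B) ⟨0, by simp⟩ ?_ ?_ ?_
  · rintro S S' hS ⟨B, hB⟩
    exact ⟨B, fun x hx hxS => hB x hx (hS hxS)⟩
  · rintro S S' ⟨B, hB⟩ ⟨B', hB'⟩
    refine ⟨max B B', fun x hx hxS t ht => ?_⟩
    rcases hxS with h | h
    · exact (hB x hx h t ht).trans (le_max_left _ _)
    · exact (hB' x hx h t ht).trans (le_max_right _ _)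
  · intro x₀ _
    obtain ⟨x, hx, hx0⟩ := hfc t₀ ht₀ x₀
    have hx' : IsIntegralCurveOn x v (Icc t₀ T) := hx.mono Icc_subset_Ici_self
    obtain ⟨δ, hδ, hd⟩ := hx'.exists_forall_dist_le fun r => by
      obtain ⟨K, hK⟩ := hv T r
      exact ⟨K, fun t ht => hK t ⟨ht₀.trans ht.1, ht.2⟩⟩
    obtain ⟨B, hB⟩ := isCompact_Icc.exists_bound_of_continuousOn hx'.continuousOn
    refine ⟨Metric.closedBall x₀ δ, mem_nhdsWithin_of_mem_nhds (Metric.closedBall_mem_nhds _ hδ),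
      B + 1, fun w hw hw0 t ht => ?_⟩
    have h1 := hd w (hw.mono Icc_subset_Ici_self)
      (by rw [hx0, dist_comm]; exact hw0) t ht
    calc ‖w t‖ = ‖x t - (x t - w t)‖ := by congr 1; abel
      _ ≤ ‖x t‖ + ‖x t - w t‖ := norm_sub_le _ _
      _ ≤ B + 1 := by rw [← dist_eq_norm]; linarith [hB t ht]

/-! ### Scales of arbitrary growth -/

/-- A locally bounded requirement on a scale can be met by a differentiable scale `θ ≥ 1` whose
derivative is at most `θ ^ 2`, however fast it has to grow. -/
theorem exists_scale {P : ℝ → ℝ → Prop} (hmono : ∀ t c c', P t c → c ≤ c' → P t c')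
    (h : ∀ T, ∃ c, ∀ t ∈ Icc 0 T, P t c) :
    ∃ θ θ' : ℝ → ℝ, (∀ t, HasDerivAt θ (θ' t) t) ∧ (∀ t, |θ' t| ≤ θ t ^ 2) ∧ (∀ t, 1 ≤ θ t) ∧
      ∀ t, 0 ≤ t → P t (θ t) := by
  -- The admissible reciprocals `w` of the scale form convex sets with locally constant selections,
  -- so a partition of unity yields a continuous selection.
  let S : ℝ → Set ℝ := fun s => {w | 0 < w ∧ w ≤ 1 ∧ ∀ t ∈ Icc 0 s, P t (1 / w)}
  have hconv : ∀ s, Convex ℝ (S s) := by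
    intro s
    refine Set.OrdConnected.convex ⟨?_⟩
    rintro x ⟨hx, -, -⟩ y ⟨-, hy1, hyP⟩ z ⟨hxz, hzy⟩
    have hz : 0 < z := hx.trans_le hxz
    exact ⟨hz, hzy.trans hy1, fun t ht => hmono _ _ _ (hyP t ht) (one_div_le_one_div_of_le hz hzy)⟩
  obtain ⟨w, hw⟩ := exists_continuous_forall_mem_convex_of_local_const hconv (fun s => by
    obtain ⟨c, hc⟩ := h (s + 1)
    refine ⟨1 / max 1 c, ?_⟩
    filter_upwards [Iic_mem_nhds (show s < s + 1 by linarith)] with y hy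
    refine ⟨by positivity, ?_, fun t ht => ?_⟩
    · rw [div_le_one (by positivity)]; exact le_max_left _ _
    · rw [one_div_one_div]
      exact hmono _ _ _ (hc t ⟨ht.1, ht.2.trans hy⟩) (le_max_right _ _))
  have hwc : Continuous w := w.continuous
  let F : ℝ → ℝ := fun t => ∫ s in (0 : ℝ)..t, w s
  have hF : ∀ t, HasDerivAt F (w t) t := fun t =>
    intervalIntegral.integral_hasDerivAt_right (hwc.intervalIntegrable _ _)
      (hwc.stronglyMeasurableAtFilter _ _) hwc.continuousAt
  -- Averaging over `[t, t + 1]` makes the reciprocal differentiable with `|ν'| ≤ 1`, because `w`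
  -- takes values in `(0, 1]`; hence `1 / ν` has derivative at most `(1 / ν) ^ 2`. The average is a
  -- value `w s` with `s > t`, and membership in `S s` covers all earlier times, in particular `t`.
  let ν : ℝ → ℝ := fun t => F (t + 1) - F t
  have hν : ∀ t, HasDerivAt ν (w (t + 1) - w t) t := fun t =>
    ((hF (t + 1)).comp_add_const t 1).sub (hF t)
  have hνw : ∀ t, ∃ s ∈ Ioo t (t + 1), ν t = w s := by
    intro t
    obtain ⟨s, hs, hs'⟩ := exists_hasDerivAt_eq_slope F w (show t < t + 1 by linarith)
      (fun x _ => (hF x).continuousAt.continuousWithinAt) (fun x _ => hF x)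
    exact ⟨s, hs, by simp [hs', ν]⟩
  have hνpos : ∀ t, 0 < ν t := fun t => by
    obtain ⟨s, -, hs⟩ := hνw t
    rw [hs]; exact (hw s).1
  refine ⟨fun t => (ν t)⁻¹, fun t => -(w (t + 1) - w t) / ν t ^ 2,
    fun t => (hν t).inv (hνpos t).ne', fun t => ?_, fun t => ?_, fun t ht => ?_⟩
  · rw [abs_div, abs_neg, abs_of_pos (pow_pos (hνpos t) 2), inv_pow, div_eq_mul_inv]
    refine mul_le_of_le_one_left (by have := hνpos t; positivity) ?_
    rw [abs_le]
    constructor <;> linarith [(hw t).1, (hw t).2.1, (hw (t + 1)).1, (hw (t + 1)).2.1]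
  · obtain ⟨s, -, hs⟩ := hνw t
    rw [one_le_inv₀ (hνpos t), hs]
    exact (hw s).2.1
  · obtain ⟨s, hs1, hs⟩ := hνw t
    have := (hw s).2.2 t ⟨ht, hs1.1.le⟩
    simpa [hs] using this

/-! ### Odd powers and saturation -/

/-- For arguments of equal sign this is superadditivity of the power on the half-line; for opposite
signs it is the power mean inequality, which produces the factor `2 ^ (m - 1)`. -/
theorem Odd.sub_pow_le {m : ℕ} (hm : Odd m) {x z : ℝ} (h : z ≤ x) :
    (x - z) ^ m ≤ 2 ^ (m - 1) * (x ^ m - z ^ m) := by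
  have hm0 : m ≠ 0 := hm.pos.ne'
  have h2 : (1 : ℝ) ≤ 2 ^ (m - 1) := one_le_pow₀ (by norm_num)
  have same : ∀ u v : ℝ, 0 ≤ v → v ≤ u → (u - v) ^ m ≤ 2 ^ (m - 1) * (u ^ m - v ^ m) := by
    intro u v hv huv
    have h1 := pow_add_pow_le (sub_nonneg.2 huv) hv hm0
    rw [sub_add_cancel] at h1
    have h3 : (u - v) ^ m ≤ u ^ m - v ^ m := by linarith
    have h4 : 0 ≤ u ^ m - v ^ m := (pow_nonneg (sub_nonneg.2 huv) _).trans h3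
    nlinarith
  rcases le_total 0 z with hz | hz
  · exact same x z hz h
  rcases le_total 0 x with hx | hx
  · have := add_pow_le hx (neg_nonneg.2 hz) m
    rwa [hm.neg_pow, ← sub_eq_add_neg, ← sub_eq_add_neg] at this
  · have := same (-z) (-x) (by linarith) (by linarith)
    rw [hm.neg_pow, hm.neg_pow] at this
    calc (x - z) ^ m = (-z - -x) ^ m := by ring
      _ ≤ _ := this
      _ = _ := by ring

/-- The projection of the real line onto `[-β, β]`. -/
noncomputable def clamp (β z : ℝ) : ℝ := max (-β) (min β z)

theorem abs_clamp_le {β : ℝ} (hβ : 0 ≤ β) (z : ℝ) : |clamp β z| ≤ β :=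
  abs_le.2 ⟨le_max_left _ _, max_le (by linarith) (min_le_left _ _)⟩

theorem clamp_of_abs_le {β z : ℝ} (h : |z| ≤ β) : clamp β z = z := by
  rw [clamp, min_eq_right (abs_le.1 h).2, max_eq_right (abs_le.1 h).1]

theorem clamp_mono (β : ℝ) : Monotone (clamp β) := fun _ _ h => by
  unfold clamp; gcongr

theorem sub_clamp_mono {β : ℝ} (hβ : 0 ≤ β) : Monotone fun z => z - clamp β z := by
  intro z x h
  simp only [clamp]
  grind

theorem abs_clamp_sub_clamp_le {β : ℝ} (hβ : 0 ≤ β) (x z : ℝ) :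
    |clamp β x - clamp β z| ≤ |x - z| := by
  wlog h : z ≤ x generalizing x z
  · rw [abs_sub_comm, abs_sub_comm x]; exact this z x (le_of_not_ge h)
  have h1 := clamp_mono β h
  have h2 := sub_clamp_mono hβ h
  simp only at h2
  rw [abs_of_nonneg (by linarith), abs_of_nonneg (by linarith)]
  linarith

theorem Continuous.clamp {X : Type*} [TopologicalSpace X] {β z : X → ℝ} (hβ : Continuous β)
    (hz : Continuous z) : Continuous fun p => clamp (β p) (z p) := by
  unfold _root_.clamp; fun_prop

/-- The power function on `[-β, β]`, extended with slope one outside. -/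
noncomputable def clampPow (β : ℝ) (m : ℕ) (z : ℝ) : ℝ := clamp β z ^ m + (z - clamp β z)

theorem clampPow_of_abs_le {β z : ℝ} (h : |z| ≤ β) (m : ℕ) : clampPow β m z = z ^ m := by
  rw [clampPow, clamp_of_abs_le h]; ring

theorem abs_clampPow_sub_le {β : ℝ} (hβ : 0 ≤ β) (m : ℕ) (x z : ℝ) :
    |clampPow β m x - clampPow β m z| ≤ (m * β ^ (m - 1) + 1) * |x - z| := by
  have h1 : |clamp β x ^ m - clamp β z ^ m| ≤ m * β ^ (m - 1) * |clamp β x - clamp β z| := by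
    refine (abs_pow_sub_pow_le _ _ _).trans ?_
    rw [mul_comm _ (m : ℝ), mul_right_comm]
    gcongr
    exact max_le (abs_clamp_le hβ _) (abs_clamp_le hβ _)
  have h2 : |(x - clamp β x) - (z - clamp β z)| ≤ |x - z| := by
    wlog h : z ≤ x generalizing x z
    · have := this z x (by rwa [abs_sub_comm, abs_sub_comm (clamp β z)]) (le_of_not_ge h)
      rwa [abs_sub_comm, abs_sub_comm x]
    have h3 := sub_clamp_mono hβ h
    have h4 := clamp_mono β h
    simp only at h3
    rw [abs_of_nonneg (by linarith), abs_of_nonneg (by linarith)]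
    linarith
  calc |clampPow β m x - clampPow β m z|
      = |(clamp β x ^ m - clamp β z ^ m) + ((x - clamp β x) - (z - clamp β z))| := by
        unfold clampPow; congr 1; ring
    _ ≤ _ := abs_add_le _ _
    _ ≤ m * β ^ (m - 1) * |x - z| + |x - z| := by
        refine add_le_add (h1.trans ?_) h2
        exact mul_le_mul_of_nonneg_left (abs_clamp_sub_clamp_le hβ x z) (by positivity)
    _ = _ := by ring

/-- An odd power has no positive lower bound on its slope, but increments longer than `ξ` see a
slope of order `ξ ^ (m - 1)`; subtracting `ξ ^ 2` pays for the short ones. With `d = x - z`, the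
proof gives `c * (d - ξ)` as a lower bound for the increment, where `c ≤ 1` lets the slope-one part
contribute, and concludes by `d * (d - ξ) ≥ (d ^ 2 - ξ ^ 2) / 2`. -/
theorem le_clampPow_sub_mul {β : ℝ} (hβ : 0 ≤ β) {m : ℕ} (hm : Odd m) {ξ : ℝ} (hξ : 0 < ξ)
    (hξ1 : ξ ≤ 1) (x z : ℝ) :
    (2 ^ m)⁻¹ * ξ ^ (m - 1) * ((x - z) ^ 2 - ξ ^ 2) ≤
      (clampPow β m x - clampPow β m z) * (x - z) := by
  wlog h : z ≤ x generalizing x z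
  · have := this z x (le_of_not_ge h)
    calc _ = (2 ^ m)⁻¹ * ξ ^ (m - 1) * ((z - x) ^ 2 - ξ ^ 2) := by ring
      _ ≤ _ := this
      _ = _ := by ring
  obtain ⟨j, rfl⟩ : ∃ j, m = j + 1 := ⟨m - 1, (Nat.sub_add_cancel hm.pos).symm⟩
  simp only [Nat.add_sub_cancel]
  set A := clamp β x - clamp β z with hA
  have hA0 : 0 ≤ A := sub_nonneg.2 (clamp_mono β h)
  have hB0 : A ≤ x - z := by
    have := sub_clamp_mono hβ h
    simp only at this
    linarith
  have h1 := hm.sub_pow_le (clamp_mono β h)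
  simp only [Nat.add_sub_cancel] at h1
  rw [← hA] at h1
  set c : ℝ := (2 ^ j)⁻¹ * ξ ^ j with hc
  have hc0 : 0 < c := by positivity
  have hc1 : c ≤ 1 := mul_le_one₀ (inv_le_one_of_one_le₀ (one_le_pow₀ (by norm_num)))
    (by positivity) (pow_le_one₀ hξ.le hξ1)
  have h2 : ξ ^ j * (A - ξ) ≤ A ^ (j + 1) := by
    rcases le_total ξ A with hξA | hξA
    · calc ξ ^ j * (A - ξ) ≤ A ^ j * A := by
            have : ξ ^ j ≤ A ^ j := by gcongr
            have := pow_pos hξ j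
            nlinarith
        _ = _ := by ring
    · exact (mul_nonpos_of_nonneg_of_nonpos (by positivity) (by linarith)).trans (by positivity)
  have h3 : c * (A - ξ) ≤ clamp β x ^ (j + 1) - clamp β z ^ (j + 1) := by
    rw [hc, mul_assoc, inv_mul_le_iff₀ (by positivity)]
    exact h2.trans h1
  have h4 : c * ((x - z) - ξ) ≤ clampPow β (j + 1) x - clampPow β (j + 1) z := by
    unfold clampPow
    nlinarith
  have h5 := mul_le_mul_of_nonneg_right h4 (sub_nonneg.2 h)
  refine le_trans ?_ h5
  have h6 : ((2 : ℝ) ^ (j + 1))⁻¹ * ξ ^ j = c / 2 := by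
    rw [hc, pow_succ]; field_simp
  rw [h6]
  nlinarith [mul_nonneg hc0.le (sq_nonneg ((x - z) - ξ))]

/-! ### Dissipation estimates for the error and its links -/

theorem abs_le_div_of_mul_le {a b c : ℝ} (hc : 0 < c) (h : c * |a| ≤ b) : |a| ≤ b / c := by
  rwa [le_div_iff₀ hc, mul_comm]

theorem head_dissipation {θ r r' e D ω : ℝ} (hθ : 1 ≤ θ) (hr : 1 ≤ r) (hr' : |r'| ≤ θ ^ 2 * r)
    (he : r * |e| ≤ ω) (hD : |D| ≤ 2 * θ * ω) :
    r' * e ^ 2 + 2 * (r * e) * D ≤ 5 * θ ^ 2 * ω ^ 2 := by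
  have hω : 0 ≤ ω := le_trans (by positivity) he
  have he1 : |e| ≤ ω := le_trans (by nlinarith [abs_nonneg e]) he
  have h1 : r' * e ^ 2 ≤ θ ^ 2 * (ω * ω) := by
    calc r' * e ^ 2 ≤ |r'| * e ^ 2 := by gcongr; exact le_abs_self _
      _ ≤ θ ^ 2 * r * e ^ 2 := by gcongr
      _ = θ ^ 2 * ((r * |e|) * |e|) := by rw [← sq_abs e]; ring
      _ ≤ _ := by gcongr
  have h2 : (r * e) * D ≤ ω * (2 * θ * ω) := by
    calc (r * e) * D ≤ |(r * e) * D| := le_abs_self _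
      _ = (r * |e|) * |D| := by rw [abs_mul, abs_mul, abs_of_pos (by linarith : 0 < r)]
      _ ≤ _ := by gcongr
  have h3 : θ * ω ^ 2 ≤ θ ^ 2 * ω ^ 2 := by gcongr; nlinarith
  nlinarith

/-- Expanding `-2 * r * (e₁ - κ * e₀) * κ * G₀` isolates the useful term `-2 * (r * κ * G₀ * e₁)`.
The remaining terms are bounded by multiples of `θ ^ 2 * ω ^ 2`, with constants `4` (`r'`), `8`
(`D₁`), `4` (`F₀`), `4` (`κ'`) and `2` (`e₀ * G₀`). -/
theorem link_dissipation {θ r r' X κ κ' e₀ e₁ F₀ G₀ D₁ ω : ℝ} (hθ : 1 ≤ θ) (hr : 1 ≤ r)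
    (hX : 1 ≤ X) (hr' : |r'| ≤ θ ^ 2 * r) (hκ : |κ| = X) (hκ' : |κ'| ≤ θ ^ 2 * X)
    (he₀ : r * X ^ 2 * |e₀| ≤ ω) (he₁ : r * |e₁| ≤ ω) (hF₀ : X * |F₀| ≤ θ * ω)
    (hG₀ : |G₀| ≤ θ * |e₁|) (hD₁ : |D₁| ≤ 2 * θ * ω) :
    r' * (e₁ - κ * e₀) ^ 2 +
        2 * r * (e₁ - κ * e₀) * (D₁ - (κ' * e₀ + κ * (F₀ + G₀))) ≤
      -2 * (r * κ * G₀ * e₁) + 22 * θ ^ 2 * ω ^ 2 := by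
  have hω : 0 ≤ ω := le_trans (by positivity) he₁
  have hr0 : 0 < r := by linarith
  have he₁' : |e₁| ≤ ω := le_trans (by nlinarith [abs_nonneg e₁]) he₁
  have hXX : X ≤ X ^ 2 := by nlinarith
  have hXe : X * |e₀| ≤ ω := le_trans (by
    have := mul_le_mul_of_nonneg_right hXX (abs_nonneg e₀)
    have := mul_nonneg (sq_nonneg X) (abs_nonneg e₀)
    nlinarith) he₀
  have hη : r * |e₁ - κ * e₀| ≤ 2 * ω := by
    calc r * |e₁ - κ * e₀| ≤ r * (|e₁| + |κ * e₀|) := by gcongr; exact abs_sub _ _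
      _ = r * |e₁| + r * X * |e₀| := by rw [abs_mul, hκ]; ring
      _ ≤ r * |e₁| + r * X ^ 2 * |e₀| := by gcongr
      _ ≤ 2 * ω := by linarith
  set η := e₁ - κ * e₀ with hηdef
  have hη' : |η| ≤ 2 * ω := le_trans (by nlinarith [abs_nonneg η]) hη
  have h1 : r' * η ^ 2 ≤ θ ^ 2 * ((2 * ω) * (2 * ω)) := by
    calc r' * η ^ 2 ≤ |r'| * η ^ 2 := by gcongr; exact le_abs_self _
      _ ≤ θ ^ 2 * r * η ^ 2 := by gcongr
      _ = θ ^ 2 * ((r * |η|) * |η|) := by rw [← sq_abs η]; ring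
      _ ≤ _ := by gcongr
  have key : ∀ u B, |u| ≤ B → r * η * u ≤ 2 * ω * B := by
    intro u B hu
    calc r * η * u ≤ |r * η * u| := le_abs_self _
      _ = (r * |η|) * |u| := by rw [abs_mul, abs_mul, abs_of_pos hr0]
      _ ≤ _ := by gcongr
  have h2 := key D₁ _ hD₁
  have h3 := key (-(κ * F₀)) (θ * ω) (by rw [abs_neg, abs_mul, hκ]; exact hF₀)
  have h4 := key (-(κ' * e₀)) (θ ^ 2 * ω) (by
    rw [abs_neg, abs_mul]
    calc |κ'| * |e₀| ≤ θ ^ 2 * X * |e₀| := by gcongr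
      _ = θ ^ 2 * (X * |e₀|) := by ring
      _ ≤ _ := by gcongr)
  have h5 : r * κ ^ 2 * e₀ * G₀ ≤ ω * (θ * ω) := by
    calc r * κ ^ 2 * e₀ * G₀ ≤ |r * κ ^ 2 * e₀ * G₀| := le_abs_self _
      _ = (r * X ^ 2 * |e₀|) * |G₀| := by
        rw [abs_mul, abs_mul, abs_mul, abs_pow, hκ, abs_of_pos hr0]
      _ ≤ ω * (θ * |e₁|) := by gcongr
      _ ≤ _ := by gcongr
  have h6 : θ * ω ^ 2 ≤ θ ^ 2 * ω ^ 2 := by gcongr; nlinarith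
  have : 2 * r * η * (D₁ - (κ' * e₀ + κ * (F₀ + G₀))) =
      2 * (r * η * D₁) + 2 * (r * η * (-(κ * F₀))) + 2 * (r * η * (-(κ' * e₀)))
        + (-2 * (r * κ * G₀ * e₁) + 2 * (r * κ ^ 2 * e₀ * G₀)) := by
    rw [hηdef]; ring
  rw [this]
  nlinarith

/-! ### Gain exponents and the Lyapunov function -/

/-- The exponents of the scale in the weights `θ ^ b i` and the links `θ ^ k i`. -/
structure GainExponents (n : ℕ) (m : ℕ → ℕ) where
  b : ℕ → ℕ
  k : ℕ → ℕ
  b_eq : ∀ i < n, b i = 2 * k i + b (i + 1) + 1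
  k_eq : ∀ i < n, k i = 2 + (b (i + 1) + 5) * (m i - 1) + b (i + 1) + 8

/-- The recursion is solved downwards from `b n`. The extra `1` in `b_eq` leaves a spare factor `θ`
in `sum_sq_le_lyap`; in `k_eq` the product `(b (i + 1) + 5) * (m i - 1)` makes up for the slope `ξ ^
(m i - 1)` at `ξ = θ ^ (-(b (i + 1) + 5))`. -/
theorem GainExponents.nonempty (n : ℕ) (m : ℕ → ℕ) : Nonempty (GainExponents n m) := by
  induction n generalizing m with
  | zero => exact ⟨⟨0, 0, by simp, by simp⟩⟩
  | succ n ih =>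
    obtain ⟨g⟩ := ih fun i => m (i + 1)
    refine ⟨⟨fun i => Nat.casesOn i
        (2 * (2 + (g.b 0 + 5) * (m 0 - 1) + g.b 0 + 8) + g.b 0 + 1) g.b,
      fun i => Nat.casesOn i (2 + (g.b 0 + 5) * (m 0 - 1) + g.b 0 + 8) g.k, ?_, ?_⟩⟩
    · rintro (_ | i) hi
      · rfl
      · exact g.b_eq i (by omega)
    · rintro (_ | i) hi
      · rfl
      · exact g.k_eq i (by omega)

namespace GainExponents

variable {n : ℕ} {m : ℕ → ℕ} (g : GainExponents n m)

theorem b_anti {i j : ℕ} (hij : i ≤ j) (hj : j ≤ n) : g.b j ≤ g.b i := by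
  induction j, hij using Nat.le_induction with
  | base => exact le_rfl
  | succ j hij ih =>
    have := g.b_eq j (by omega)
    exact le_trans (by omega) (ih (by omega))

/-- The quadratic Lyapunov function of the observer error. -/
noncomputable def lyap (θ : ℝ) (σ : ℕ → ℝ) (e : Fin (n + 1) → ℝ) : ℝ :=
  θ ^ g.b 0 * e 0 ^ 2 + ∑ j : Fin n,
    θ ^ g.b (j + 1) * (e j.succ - σ j * θ ^ g.k j * e j.castSucc) ^ 2

/-- The time derivative of `lyap` when the scale and the error have derivatives `θ'`, `e'`. -/
noncomputable def lyapDeriv (θ θ' : ℝ) (σ : ℕ → ℝ) (e e' : Fin (n + 1) → ℝ) : ℝ :=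
  (g.b 0 * θ ^ (g.b 0 - 1) * θ' * e 0 ^ 2 + 2 * (θ ^ g.b 0 * e 0) * e' 0) + ∑ j : Fin n,
    (g.b (j + 1) * θ ^ (g.b (j + 1) - 1) * θ' * (e j.succ - σ j * θ ^ g.k j * e j.castSucc) ^ 2 +
      2 * θ ^ g.b (j + 1) * (e j.succ - σ j * θ ^ g.k j * e j.castSucc) *
        (e' j.succ - (σ j * (g.k j * θ ^ (g.k j - 1) * θ') * e j.castSucc +
          σ j * θ ^ g.k j * e' j.castSucc)))

/-- The output injection gain. -/
noncomputable def gain (θ : ℝ) (σ : ℕ → ℝ) (i : ℕ) : ℝ :=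
  θ ^ (g.b 0 + 8) * ∏ j ∈ Finset.range i, (σ j * θ ^ g.k j)

theorem hasDerivWithinAt_lyap {θ : ℝ → ℝ} {θ' : ℝ} {σ : ℕ → ℝ} {e : ℝ → Fin (n + 1) → ℝ}
    {e' : Fin (n + 1) → ℝ} {s : Set ℝ} {t : ℝ} (hθ : HasDerivWithinAt θ θ' s t)
    (he : ∀ i, HasDerivWithinAt (fun t => e t i) (e' i) s t) :
    HasDerivWithinAt (fun t => g.lyap (θ t) σ (e t)) (g.lyapDeriv (θ t) θ' σ (e t) e') s t := by
  unfold lyap lyapDeriv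
  refine HasDerivWithinAt.add ?_ (HasDerivWithinAt.fun_sum fun j _ => ?_)
  · refine ((hθ.fun_pow (g.b 0)).fun_mul ((he 0).fun_pow 2)).congr_deriv ?_
    simp; ring
  · refine ((hθ.fun_pow _).fun_mul (((he j.succ).fun_sub
      (((hθ.fun_pow (g.k j)).const_mul (σ j)).fun_mul (he j.castSucc))).fun_pow 2)).congr_deriv ?_
    simp; ring

/-- Recovering `e (j+1)` from its link costs `κ j * e j`, whose weighted square is `1 / θ ≤ 1 / 4`
of the weighted square of `e j`. So the weighted sum satisfies `N ≤ 2 * V + N / 2`. -/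
theorem sum_sq_le_lyap {θ : ℝ} (hθ : 4 ≤ θ) {σ : ℕ → ℝ} (hσ : ∀ i, |σ i| = 1)
    (e : Fin (n + 1) → ℝ) : ∑ i, e i ^ 2 ≤ 4 * g.lyap θ σ e := by
  set N : ℝ := ∑ i : Fin (n + 1), θ ^ g.b i * e i ^ 2 with hN
  have hle : ∑ i, e i ^ 2 ≤ N := by
    refine Finset.sum_le_sum fun i _ => le_mul_of_one_le_left (sq_nonneg _) ?_
    exact one_le_pow₀ (by linarith)
  have h1 : N = θ ^ g.b 0 * e 0 ^ 2 + ∑ j : Fin n, θ ^ g.b (j + 1) * e j.succ ^ 2 := by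
    rw [hN, Fin.sum_univ_succ]; simp
  have h2 : ∑ j : Fin n, θ ^ g.b j * e j.castSucc ^ 2 ≤ N := by
    rw [hN, Fin.sum_univ_castSucc]
    simp only [Fin.val_castSucc, le_add_iff_nonneg_right]
    positivity
  have h3 : ∀ j : Fin n, θ ^ g.b (j + 1) * e j.succ ^ 2 ≤
      2 * (θ ^ g.b (j + 1) * (e j.succ - σ j * θ ^ g.k j * e j.castSucc) ^ 2) +
        (1 / 2) * (θ ^ g.b j * e j.castSucc ^ 2) := by
    intro j
    have hb := g.b_eq j j.2
    have hσj : σ j ^ 2 = 1 := by rw [← sq_abs, hσ]; norm_num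
    have h4 : θ ^ g.b (j + 1) * (σ j * θ ^ g.k j * e j.castSucc) ^ 2 ≤
        (1 / 4) * (θ ^ g.b j * e j.castSucc ^ 2) := by
      have : θ ^ g.b j * e j.castSucc ^ 2 =
          θ * (θ ^ g.b (j + 1) * (σ j * θ ^ g.k j * e j.castSucc) ^ 2) := by
        rw [hb, mul_pow, mul_pow, hσj]; ring
      rw [this]
      have : 0 ≤ θ ^ g.b (j + 1) * (σ j * θ ^ g.k j * e j.castSucc) ^ 2 := by positivity
      nlinarith
    have h5 : 0 ≤ θ ^ g.b (j + 1) := by positivity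
    nlinarith [mul_nonneg h5 (sq_nonneg (e j.succ - 2 * (σ j * θ ^ g.k j * e j.castSucc)))]
  have h6 := Finset.sum_le_sum fun j (_ : j ∈ (Finset.univ : Finset (Fin n))) => h3 j
  rw [Finset.sum_add_distrib, ← Finset.mul_sum, ← Finset.mul_sum] at h6
  have h7 : 0 ≤ θ ^ g.b 0 * e 0 ^ 2 := by positivity
  unfold lyap
  linarith

/-- The gains are in the ratio of the links, which removes the injection from the derivative of
every link. -/
theorem gain_succ (θ : ℝ) (σ : ℕ → ℝ) (i : ℕ) :
    g.gain θ σ (i + 1) = σ i * θ ^ g.k i * g.gain θ σ i := by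
  rw [gain, gain, Finset.prod_range_succ]; ring

/-- The dissipation inequality of the observer error `e' = F + G - gain * e 0`: here `F` is the
increment of the lower triangular part, and `G` that of the superdiagonal part, of the field. -/
theorem lyapDeriv_le {θ θ' : ℝ} (hθ : 22 * (n + 1) ≤ θ) (hθ' : |θ'| ≤ θ ^ 2)
    (hb : g.b 0 ≤ θ) {σ : ℕ → ℝ} (hσ : ∀ i, |σ i| = 1) {e F G : Fin (n + 1) → ℝ}
    (hF : ∀ i M, (∀ j ≤ i, |e j| ≤ M) → |F i| ≤ θ * M)
    (hG : ∀ j : Fin n, |G j.castSucc| ≤ θ * |e j.succ|) (hG' : G (Fin.last n) = 0)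
    (hgood : ∀ j : Fin n, θ ^ (2 * (g.b (j + 1) + 4)) * e j.succ ^ 2 - (θ ^ 2)⁻¹ ≤
      θ ^ g.b (j + 1) * (σ j * θ ^ g.k j) * G j.castSucc * e j.succ) :
    g.lyapDeriv θ θ' σ e (fun i => F i + G i - g.gain θ σ i * e 0) ≤ -g.lyap θ σ e + θ⁻¹ := by
  have hn : (1 : ℝ) ≤ n + 1 := by simp
  have hθ1 : 1 ≤ θ := by linarith
  have hθ0 : 0 < θ := by linarith
  -- `W` is the available damping. The surplus `θ ^ 8` over the weights `θ ^ (2 * b i)` gives `W = θ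
  -- ^ 8 * ω ^ 2`, against cross terms of order `θ ^ 2 * ω ^ 2`.
  set W : ℝ := ∑ i : Fin (n + 1), θ ^ (2 * (g.b i + 4)) * e i ^ 2 with hW
  have hW0 : 0 ≤ W := Finset.sum_nonneg fun i _ => by positivity
  set ω : ℝ := √W / θ ^ 4 with hω
  have hω0 : 0 ≤ ω := by positivity
  have hωW : θ ^ 8 * ω ^ 2 = W := by
    rw [hω, div_pow, Real.sq_sqrt hW0]; field_simp
  have hbi : ∀ i : ℕ, i ≤ n → (g.b i : ℝ) ≤ θ := fun i hi =>
    le_trans (by exact_mod_cast g.b_anti (Nat.zero_le i) hi) hb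
  have hki : ∀ j : Fin n, (g.k j : ℝ) ≤ θ := fun j => by
    refine le_trans ?_ (hbi j j.2.le)
    have := g.b_eq j j.2
    exact_mod_cast (by omega)
  -- weighted bounds on the error
  have he : ∀ i : Fin (n + 1), θ ^ g.b i * |e i| ≤ ω := by
    intro i
    rw [hω, le_div_iff₀ (by positivity)]
    refine Real.le_sqrt_of_sq_le ?_
    have : (θ ^ g.b i * |e i| * θ ^ 4) ^ 2 = θ ^ (2 * (g.b i + 4)) * e i ^ 2 := by
      rw [mul_pow, mul_pow, sq_abs]; ring
    rw [this]
    exact Finset.single_le_sum (f := fun i : Fin (n + 1) => θ ^ (2 * (g.b i + 4)) * e i ^ 2)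
      (fun i _ => by positivity) (Finset.mem_univ i)
  clear_value ω W
  have hFi : ∀ i : Fin (n + 1), θ ^ g.b i * |F i| ≤ θ * ω := by
    intro i
    have := hF i (ω / θ ^ g.b i) fun j hj => by
      have h1 : θ ^ g.b i ≤ θ ^ g.b j :=
        pow_le_pow_right₀ hθ1 (g.b_anti (Fin.le_def.1 hj) i.is_le)
      exact (abs_le_div_of_mul_le (pow_pos hθ0 _) (he j)).trans
        (div_le_div_of_nonneg_left hω0 (pow_pos hθ0 _) h1)
    calc θ ^ g.b i * |F i| ≤ θ ^ g.b i * (θ * (ω / θ ^ g.b i)) := by gcongr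
      _ = θ * ω := by field_simp
  have hone : ∀ i, (1 : ℝ) ≤ θ ^ i := fun i => one_le_pow₀ hθ1
  have hF1 : ∀ i : Fin (n + 1), |F i| ≤ θ * ω := fun i =>
    (le_mul_of_one_le_left (abs_nonneg _) (hone _)).trans (hFi i)
  have he1 : ∀ i : Fin (n + 1), |e i| ≤ ω := fun i =>
    (le_mul_of_one_le_left (abs_nonneg _) (hone _)).trans (he i)
  have hG1 : ∀ i : Fin (n + 1), |G i| ≤ θ * ω := by
    intro i
    refine Fin.lastCases ?_ (fun j => ?_) i
    · rw [hG', abs_zero]; positivity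
    · exact (hG j).trans (by gcongr; exact he1 _)
  have hD : ∀ i : Fin (n + 1), |F i + G i| ≤ 2 * θ * ω := fun i =>
    (abs_add_le _ _).trans (by linarith [hF1 i, hG1 i])
  have hpow : ∀ j : ℕ, (j : ℝ) ≤ θ → |(j : ℝ) * θ ^ (j - 1) * θ'| ≤ θ ^ 2 * θ ^ j := by
    intro j hj
    rcases j with _ | j
    · simp; positivity
    · rw [abs_mul, abs_of_nonneg (by positivity), Nat.add_sub_cancel]
      calc ((j + 1 : ℕ) : ℝ) * θ ^ j * |θ'| ≤ θ * θ ^ j * θ ^ 2 := by gcongr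
        _ = _ := by ring
  have hhead := head_dissipation hθ1 (hone (g.b 0)) (hpow _ (hbi 0 (Nat.zero_le _))) (he 0) (hD 0)
  have hlink : ∀ j : Fin n, _ := fun j =>
    link_dissipation (κ := σ j * θ ^ g.k j) (κ' := σ j * (g.k j * θ ^ (g.k j - 1) * θ'))
      (e₀ := e j.castSucc) (e₁ := e j.succ) (F₀ := F j.castSucc) (G₀ := G j.castSucc)
      (D₁ := F j.succ + G j.succ) (ω := ω)
      hθ1 (hone (g.b (j + 1))) (hone (g.k j)) (hpow _ (hbi _ j.2))
      (by rw [abs_mul, hσ, one_mul, abs_of_pos (by positivity)])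
      (by rw [abs_mul, hσ, one_mul]; exact hpow _ (hki j))
      (by
        refine le_trans ?_ (he j.castSucc)
        gcongr
        rw [Fin.val_castSucc, g.b_eq j j.2, ← pow_mul, ← pow_add]
        exact pow_le_pow_right₀ hθ1 (by omega))
      (by simpa using he j.succ)
      (by
        refine le_trans ?_ (hFi j.castSucc)
        gcongr
        rw [Fin.val_castSucc, g.b_eq j j.2]; omega)
      (hG j) (hD j.succ)
  -- the injection acts on the first coordinate only
  have hcancel : ∀ j : Fin n,
      (F j.succ + G j.succ - g.gain θ σ j.succ * e 0) -
        (σ j * (g.k j * θ ^ (g.k j - 1) * θ') * e j.castSucc +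
          σ j * θ ^ g.k j * (F j.castSucc + G j.castSucc - g.gain θ σ j.castSucc * e 0)) =
      (F j.succ + G j.succ) - (σ j * (g.k j * θ ^ (g.k j - 1) * θ') * e j.castSucc +
          σ j * θ ^ g.k j * (F j.castSucc + G j.castSucc)) := by
    intro j
    rw [Fin.val_succ, gain_succ, Fin.val_castSucc]; ring
  have hW1 : W = θ ^ (2 * (g.b 0 + 4)) * e 0 ^ 2 +
      ∑ j : Fin n, θ ^ (2 * (g.b (j + 1) + 4)) * e j.succ ^ 2 := by
    rw [hW, Fin.sum_univ_succ]; simp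
  have hsum : g.lyapDeriv θ θ' σ e (fun i => F i + G i - g.gain θ σ i * e 0) ≤
      -2 * W + 22 * (n + 1) * (θ ^ 2 * ω ^ 2) + 2 * (n * (θ ^ 2)⁻¹) := by
    unfold lyapDeriv
    have h1 : ∀ j : Fin n, _ ≤ -2 * (θ ^ (2 * (g.b (j + 1) + 4)) * e j.succ ^ 2) +
        (2 * (θ ^ 2)⁻¹ + 22 * (θ ^ 2 * ω ^ 2)) := fun j =>
      (hlink j).trans (by have := hgood j; linarith)
    have h2 := (Finset.sum_le_sum fun j (_ : j ∈ (Finset.univ : Finset (Fin n))) => h1 j).trans_eq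
      Finset.sum_add_distrib
    rw [← Finset.mul_sum] at h2
    simp only [Finset.sum_const, Finset.card_univ, Fintype.card_fin, nsmul_eq_mul] at h2
    have h3 : 2 * (θ ^ g.b 0 * e 0) * (F 0 + G 0 - g.gain θ σ ((0 : Fin (n + 1)) : ℕ) * e 0) =
        2 * (θ ^ g.b 0 * e 0) * (F 0 + G 0) - 2 * (θ ^ (2 * (g.b 0 + 4)) * e 0 ^ 2) := by
      simp only [gain, Fin.val_zero, Finset.range_zero, Finset.prod_empty]; ring
    simp only [hcancel, h3]
    rw [hW1]
    have h4 : 0 ≤ θ ^ 2 * ω ^ 2 := by positivity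
    linarith
  have hlyap : g.lyap θ σ e ≤ 4 * (n + 1) * ω ^ 2 := by
    have h1 : ∀ j : Fin n,
        θ ^ g.b (j + 1) * (e j.succ - σ j * θ ^ g.k j * e j.castSucc) ^ 2 ≤ 4 * ω ^ 2 := by
      intro j
      have hη : θ ^ g.b (j + 1) * |e j.succ - σ j * θ ^ g.k j * e j.castSucc| ≤ 2 * ω := by
        calc θ ^ g.b (j + 1) * |e j.succ - σ j * θ ^ g.k j * e j.castSucc|
            ≤ θ ^ g.b (j + 1) * (|e j.succ| + |σ j * θ ^ g.k j * e j.castSucc|) := by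
              gcongr; exact abs_sub _ _
          _ = θ ^ g.b (j + 1) * |e j.succ| + θ ^ (g.b (j + 1) + g.k j) * |e j.castSucc| := by
              rw [abs_mul, abs_mul, hσ, abs_of_pos (by positivity : 0 < θ ^ g.k j)]; ring
          _ ≤ θ ^ g.b j.succ * |e j.succ| + θ ^ g.b j.castSucc * |e j.castSucc| := by
              gcongr
              · simp
              · rw [Fin.val_castSucc, g.b_eq j j.2]; omega
          _ ≤ 2 * ω := by linarith [he j.succ, he j.castSucc]
      set η := e j.succ - σ j * θ ^ g.k j * e j.castSucc
      have hη' : |η| ≤ 2 * ω := (le_mul_of_one_le_left (abs_nonneg _) (hone _)).trans hη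
      calc θ ^ g.b (j + 1) * η ^ 2 = (θ ^ g.b (j + 1) * |η|) * |η| := by rw [← sq_abs]; ring
        _ ≤ (2 * ω) * (2 * ω) := by gcongr
        _ = _ := by ring
    have h2 := Finset.sum_le_sum fun j (_ : j ∈ (Finset.univ : Finset (Fin n))) => h1 j
    simp only [Finset.sum_const, Finset.card_univ, Fintype.card_fin, nsmul_eq_mul] at h2
    have h3 : θ ^ g.b 0 * e 0 ^ 2 ≤ ω ^ 2 := by
      calc θ ^ g.b 0 * e 0 ^ 2 = (θ ^ g.b 0 * |e 0|) * |e 0| := by rw [← sq_abs]; ring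
        _ ≤ ω * ω := by
          gcongr
          · exact he 0
          · exact he1 0
        _ = _ := by ring
    unfold lyap
    nlinarith [sq_nonneg ω]
  have hω2 : 0 ≤ ω ^ 2 := sq_nonneg ω
  -- The damping absorbs the cross terms and still leaves a full `-V`.
  have h1 : 22 * (n + 1) * (θ ^ 2 * ω ^ 2) + 4 * (n + 1) * ω ^ 2 ≤ 2 * W := by
    rw [← hωW]
    have h2 : 22 * (n + 1) * (θ ^ 2 * ω ^ 2) ≤ θ * (θ ^ 2 * ω ^ 2) := by gcongr
    have h3 : 4 * (n + 1) * ω ^ 2 ≤ θ * ω ^ 2 := by gcongr; linarith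
    have h4 : θ * (θ ^ 2 * ω ^ 2) ≤ θ ^ 8 * ω ^ 2 := by
      calc θ * (θ ^ 2 * ω ^ 2) = θ ^ 3 * ω ^ 2 := by ring
        _ ≤ _ := by gcongr; norm_num
    have h5 : θ * ω ^ 2 ≤ θ ^ 8 * ω ^ 2 := by
      gcongr
      exact le_self_pow₀ hθ1 (by norm_num)
    linarith
  have h2 : 2 * (n * (θ ^ 2)⁻¹) ≤ θ⁻¹ := by
    have : θ⁻¹ = θ * (θ ^ 2)⁻¹ := by field_simp
    rw [this, ← mul_assoc]
    gcongr
    linarith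
  linarith

end GainExponents

/-- The superdiagonal term of the error system is coercive, up to an error that the scale makes
small. -/
theorem coercive_superdiagonal {θ β A σ : ℝ} {m b k : ℕ} (hθ : 1 ≤ θ) (hβ : 0 ≤ β) (hm : Odd m)
    (hk : k = 2 + (b + 5) * (m - 1) + b + 8) (hσ : σ * A = |A|) (hA : 1 ≤ θ * ((2 ^ m)⁻¹ * |A|))
    (x z : ℝ) :
    θ ^ (2 * (b + 4)) * (x - z) ^ 2 - (θ ^ 2)⁻¹ ≤
      θ ^ b * (σ * θ ^ k) * (A * (clampPow β m x - clampPow β m z)) * (x - z) := by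
  have hθ0 : 0 < θ := by linarith
  -- Chosen so that the loss `θ ^ (2 * (b + 4)) * ξ ^ 2` is exactly `θ ^ (-2)`.
  set ξ : ℝ := (θ ^ (b + 5))⁻¹ with hξdef
  have hξ : 0 < ξ := by positivity
  have hξ1 : ξ ≤ 1 := inv_le_one_of_one_le₀ (one_le_pow₀ hθ)
  have hR : θ ^ b * (σ * θ ^ k) * (A * (clampPow β m x - clampPow β m z)) * (x - z) =
      θ ^ (b + k) * |A| * ((clampPow β m x - clampPow β m z) * (x - z)) := by
    rw [← hσ]; ring
  have hξ2 : θ ^ (2 * (b + 4)) * ξ ^ 2 = (θ ^ 2)⁻¹ := by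
    rw [hξdef, inv_pow, ← pow_mul, show (b + 5) * 2 = 2 * (b + 4) + 2 by ring, pow_add]
    field_simp
  rw [hR, ← hξ2, ← mul_sub]
  rcases le_total (|x - z|) ξ with h | h
  · have h1 : (x - z) ^ 2 ≤ ξ ^ 2 := by rw [← sq_abs]; gcongr
    refine (mul_nonpos_of_nonneg_of_nonpos (by positivity) (by linarith)).trans
      (mul_nonneg (by positivity) ?_)
    rcases eq_or_ne x z with rfl | hxz
    · simp
    -- With `ξ` replaced by `|x - z|` the lower bound is zero, so this is plain monotonicity.
    · have := le_clampPow_sub_mul hβ hm (abs_pos.2 (sub_ne_zero.2 hxz)) (h.trans hξ1) x z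
      simpa using this
  · have h1 : 0 ≤ (x - z) ^ 2 - ξ ^ 2 := by
      rw [← sq_abs (x - z)]
      have : ξ ^ 2 ≤ |x - z| ^ 2 := by gcongr
      linarith
    have h2 := le_clampPow_sub_mul hβ hm hξ hξ1 x z
    have h3 : θ ^ (2 * (b + 4)) ≤ θ ^ (b + k) * |A| * ((2 ^ m)⁻¹ * ξ ^ (m - 1)) := by
      have h4 : θ ^ (b + k) * ξ ^ (m - 1) = θ ^ (2 * b + 10) := by
        rw [hξdef, inv_pow, ← pow_mul, hk,
          show b + (2 + (b + 5) * (m - 1) + b + 8) = 2 * b + 10 + (b + 5) * (m - 1) by ring,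
          pow_add]
        field_simp
      calc θ ^ (2 * (b + 4)) ≤ θ ^ (2 * b + 9) * 1 := by
            rw [mul_one]; exact pow_le_pow_right₀ hθ (by omega)
        _ ≤ θ ^ (2 * b + 9) * (θ * ((2 ^ m)⁻¹ * |A|)) := by gcongr
        _ = θ ^ (2 * b + 10) * ((2 ^ m)⁻¹ * |A|) := by ring
        _ = _ := by rw [← h4]; ring
    calc _ ≤ θ ^ (b + k) * |A| * ((2 ^ m)⁻¹ * ξ ^ (m - 1)) * ((x - z) ^ 2 - ξ ^ 2) := by gcongr
      _ = θ ^ (b + k) * |A| * ((2 ^ m)⁻¹ * ξ ^ (m - 1) * ((x - z) ^ 2 - ξ ^ 2)) := by ring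
      _ ≤ _ := by gcongr

/-! ### The saturated high-gain observer -/

section Observer

variable {n : ℕ}

/-- The constants of the triangular system on the box `[-β, β]` at time `t` are dominated by
`c`. -/
structure ScaleDominates (f : (i : Fin (n + 1)) → ℝ → (Fin (i + 1) → ℝ) → ℝ)
    (a : Fin n → ℝ → ℝ → ℝ) (m : Fin n → ℕ) (β t c : ℝ) : Prop where
  lipschitz : ∀ i : Fin (n + 1), ∀ u v : Fin (i + 1) → ℝ, ‖u‖ ≤ β → ‖v‖ ≤ β →
    |f i t u - f i t v| ≤ c * ‖u - v‖
  upper : ∀ i y, |y| ≤ β → |a i t y| * (m i * β ^ (m i - 1) + 1) ≤ c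
  lower : ∀ i y, |y| ≤ β → 1 ≤ c * ((2 ^ m i)⁻¹ * |a i t y|)

theorem ScaleDominates.mono {f : (i : Fin (n + 1)) → ℝ → (Fin (i + 1) → ℝ) → ℝ}
    {a : Fin n → ℝ → ℝ → ℝ} {m : Fin n → ℕ} {β t c c' : ℝ} (h : ScaleDominates f a m β t c)
    (hc : c ≤ c') : ScaleDominates f a m β t c' where
  lipschitz i u v hu hv := (h.lipschitz i u v hu hv).trans (by gcongr)
  upper i y hy := (h.upper i y hy).trans hc
  lower i y hy := (h.lower i y hy).trans (by gcongr)

theorem exists_scaleDominates {f : (i : Fin (n + 1)) → ℝ → (Fin (i + 1) → ℝ) → ℝ}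
    {a : Fin n → ℝ → ℝ → ℝ} {m : Fin n → ℕ}
    (hf : ∀ i : Fin (n + 1),
      ContDiffOn ℝ 1 (fun p : ℝ × (Fin (i + 1) → ℝ) => f i p.1 p.2) (Ici 0 ×ˢ univ))
    (ha : ∀ i : Fin n, ContinuousOn (fun p : ℝ × ℝ => a i p.1 p.2) (Ici 0 ×ˢ univ))
    (hpos : ∀ (i : Fin n) (t : ℝ), 0 ≤ t → ∀ y : ℝ, 0 < |a i t y|)
    {β : ℝ → ℝ} (hβ : Continuous β) (hβ0 : ∀ t, 0 ≤ β t) (T : ℝ) :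
    ∃ c, ∀ t ∈ Icc 0 T, ScaleDominates f a m (β t) t c := by
  obtain ⟨B, hB⟩ := isCompact_Icc.exists_bound_of_continuousOn (s := Icc 0 T) hβ.continuousOn
  have hβB : ∀ t ∈ Icc 0 T, β t ≤ B := fun t ht => (le_abs_self _).trans (hB t ht)
  have h1 : ∀ i : Fin (n + 1), ∃ K : NNReal, LipschitzOnWith K
      (fun p : ℝ × (Fin (i + 1) → ℝ) => f i p.1 p.2) (Icc 0 T ×ˢ Metric.closedBall 0 B) :=
    fun i => ((hf i).mono (prod_mono Icc_subset_Ici_self (subset_univ _))).exists_lipschitzOnWith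
      one_ne_zero ((convex_Icc _ _).prod (convex_closedBall _ _))
      (isCompact_Icc.prod (isCompact_closedBall _ _))
  choose K hK using h1
  have hsub : Icc 0 T ×ˢ Icc (-B) B ⊆ Ici (0 : ℝ) ×ˢ (univ : Set ℝ) :=
    prod_mono Icc_subset_Ici_self (subset_univ _)
  have hcomp : IsCompact (Icc 0 T ×ˢ Icc (-B) B) := isCompact_Icc.prod isCompact_Icc
  have h2 : ∀ i : Fin n, ∃ C, ∀ p ∈ Icc 0 T ×ˢ Icc (-B) B, ‖a i p.1 p.2‖ ≤ C :=
    fun i => hcomp.exists_bound_of_continuousOn ((ha i).mono hsub)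
  choose C hC using h2
  have h3 : ∀ i : Fin n, ∃ C, ∀ p ∈ Icc 0 T ×ˢ Icc (-B) B, ‖(a i p.1 p.2)⁻¹‖ ≤ C :=
    fun i => hcomp.exists_bound_of_continuousOn (((ha i).mono hsub).inv₀ fun p hp =>
      abs_pos.1 (hpos i p.1 hp.1.1 p.2))
  choose D hD using h3
  obtain ⟨c₁, hc₁⟩ := (finite_range fun i => (K i : ℝ)).bddAbove
  obtain ⟨c₂, hc₂⟩ := (finite_range fun i => C i * (m i * B ^ (m i - 1) + 1)).bddAbove
  obtain ⟨c₃, hc₃⟩ := (finite_range fun i => 2 ^ m i * D i).bddAbove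
  refine ⟨max c₁ (max c₂ c₃), fun t ht => ⟨fun i u v hu hv => ?_, fun i y hy => ?_,
    fun i y hy => ?_⟩⟩
  · have := (hK i).dist_le_mul (t, u) ⟨ht, by simpa using hu.trans (hβB t ht)⟩ (t, v)
      ⟨ht, by simpa using hv.trans (hβB t ht)⟩
    rw [Prod.dist_eq, dist_self, max_eq_right dist_nonneg, dist_eq_norm,
      dist_eq_norm, Real.norm_eq_abs] at this
    refine this.trans ?_
    dsimp only
    gcongr
    exact (hc₁ ⟨i, rfl⟩).trans (le_max_left _ _)
  · have hyB : (t, y) ∈ Icc 0 T ×ˢ Icc (-B) B := ⟨ht, abs_le.1 (hy.trans (hβB t ht))⟩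
    have h0 := hβ0 t
    have h1 := hβB t ht
    have hCi := hC i _ hyB
    rw [Real.norm_eq_abs] at hCi
    calc |a i t y| * (m i * β t ^ (m i - 1) + 1) ≤ C i * (m i * B ^ (m i - 1) + 1) := by
          gcongr
          exact (abs_nonneg _).trans hCi
      _ ≤ c₂ := hc₂ ⟨i, rfl⟩
      _ ≤ _ := (le_max_left _ _).trans (le_max_right _ _)
  · have hyB : (t, y) ∈ Icc 0 T ×ˢ Icc (-B) B := ⟨ht, abs_le.1 (hy.trans (hβB t ht))⟩
    have hDi := hD i _ hyB
    have hp := hpos i t ht.1 y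
    rw [norm_inv, Real.norm_eq_abs, inv_le_iff_one_le_mul₀ hp] at hDi
    calc 1 ≤ D i * |a i t y| := hDi
      _ = (2 ^ m i * D i) * ((2 ^ m i)⁻¹ * |a i t y|) := by field_simp
      _ ≤ _ := by
        gcongr
        exact (hc₃ ⟨i, rfl⟩).trans ((le_max_right _ _).trans (le_max_right _ _))

/-- The high-gain observer of the triangular system. -/
noncomputable def observerField (f : (i : Fin (n + 1)) → ℝ → (Fin (i + 1) → ℝ) → ℝ)
    (a : Fin n → ℝ → ℝ → ℝ) (m : Fin n → ℕ) (β : ℝ → ℝ) (L : ℕ → ℝ → ℝ) (t : ℝ)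
    (z : EuclideanSpace ℝ (Fin (n + 1))) (y : ℝ) : EuclideanSpace ℝ (Fin (n + 1)) :=
  WithLp.toLp 2 fun i =>
    f i t (fun j => clamp (β t) (z (Fin.castLE i.isLt j))) +
      (if hi : (i : ℕ) < n then a ⟨i, hi⟩ t (clamp (β t) y) *
        clampPow (β t) (m ⟨i, hi⟩) (z (Fin.succ ⟨i, hi⟩)) else 0) + L i t * (y - z 0)

theorem norm_clamp_le {ι : Type*} [Fintype ι] {β : ℝ} (hβ : 0 ≤ β) (z : ι → ℝ) :
    ‖fun j => clamp β (z j)‖ ≤ β :=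
  (pi_norm_le_iff_of_nonneg hβ).2 fun j => abs_clamp_le hβ (z j)

theorem continuousOn_observerField {f : (i : Fin (n + 1)) → ℝ → (Fin (i + 1) → ℝ) → ℝ}
    {a : Fin n → ℝ → ℝ → ℝ} {m : Fin n → ℕ}
    (hf : ∀ i : Fin (n + 1),
      ContinuousOn (fun p : ℝ × (Fin (i + 1) → ℝ) => f i p.1 p.2) (Ici 0 ×ˢ univ))
    (ha : ∀ i : Fin n, ContinuousOn (fun p : ℝ × ℝ => a i p.1 p.2) (Ici 0 ×ˢ univ))
    {β : ℝ → ℝ} (hβ : Continuous β) {L : ℕ → ℝ → ℝ} (hL : ∀ i, Continuous (L i)) :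
    ContinuousOn (fun p : ℝ × EuclideanSpace ℝ (Fin (n + 1)) × ℝ =>
      observerField f a m β L p.1 p.2.1 p.2.2) (Ici 0 ×ˢ univ) := by
  refine (PiLp.continuous_toLp 2 _).comp_continuousOn (continuousOn_pi.2 fun i => ?_)
  refine ContinuousOn.add (ContinuousOn.add ?_ ?_) (Continuous.continuousOn ?_)
  · refine (hf i).comp (f := fun p : ℝ × EuclideanSpace ℝ (Fin (n + 1)) × ℝ =>
      (p.1, fun j => clamp (β p.1) (p.2.1 (Fin.castLE i.isLt j)))) (Continuous.continuousOn ?_)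
      fun p hp => ⟨hp.1, trivial⟩
    exact continuous_fst.prodMk (continuous_pi fun j =>
      (hβ.comp continuous_fst).clamp (by fun_prop))
  · split_ifs with hi
    · refine ContinuousOn.mul ?_ (Continuous.continuousOn ?_)
      · refine (ha ⟨i, hi⟩).comp (f := fun p : ℝ × EuclideanSpace ℝ (Fin (n + 1)) × ℝ =>
          (p.1, clamp (β p.1) p.2.2)) (Continuous.continuousOn ?_) fun p hp => ⟨hp.1, trivial⟩
        exact continuous_fst.prodMk ((hβ.comp continuous_fst).clamp (by fun_prop))
      · have hz : Continuous fun p : ℝ × EuclideanSpace ℝ (Fin (n + 1)) × ℝ =>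
          p.2.1 (Fin.succ ⟨i, hi⟩) := by fun_prop
        have hc := (hβ.comp continuous_fst).clamp hz
        exact (hc.pow _).add (hz.sub hc)
    · exact continuousOn_const
  · have := (hL i).comp (continuous_fst (X := ℝ) (Y := EuclideanSpace ℝ (Fin (n + 1)) × ℝ))
    exact this.mul (by fun_prop)

/-- Uniformity in `y` comes from clamping the output as well; the observer then survives outputs of
solutions outside its design ball, as switching requires. -/
theorem exists_lipschitzWith_observerField
    {f : (i : Fin (n + 1)) → ℝ → (Fin (i + 1) → ℝ) → ℝ} {a : Fin n → ℝ → ℝ → ℝ} {m : Fin n → ℕ}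
    {β : ℝ → ℝ} (hβ : ∀ t, 0 ≤ β t) {L : ℕ → ℝ → ℝ} {S : Set ℝ} {c : ℝ}
    (hc : ∀ t ∈ S, ScaleDominates f a m (β t) t c) (hL : ∀ i ≤ n, ∀ t ∈ S, |L i t| ≤ c) :
    ∃ K : NNReal, ∀ t ∈ S, ∀ y, LipschitzWith K fun z => observerField f a m β L t z y := by
  obtain rfl | ⟨t₀, ht₀⟩ := S.eq_empty_or_nonempty
  · exact ⟨0, by simp⟩
  have hc0 : 0 ≤ c := (abs_nonneg _).trans (hL 0 (Nat.zero_le _) t₀ ht₀)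
  obtain ⟨K, hK⟩ : ∃ K : NNReal, LipschitzWith K
    (WithLp.toLp 2 : (Fin (n + 1) → ℝ) → EuclideanSpace ℝ (Fin (n + 1))) :=
    ⟨_, PiLp.lipschitzWith_toLp 2 _⟩
  refine ⟨K * (3 * c).toNNReal, fun t ht y => hK.comp ?_⟩
  refine LipschitzWith.of_dist_le_mul fun z w => ?_
  have hd : 0 ≤ dist z w := dist_nonneg
  have hzw : ∀ j, |z j - w j| ≤ dist z w := fun j => by
    rw [dist_eq_norm]; exact PiLp.norm_apply_le (z - w) j
  refine (dist_pi_le_iff (by positivity)).2 fun i => ?_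
  have h1 : |f i t (fun j => clamp (β t) (z (Fin.castLE i.isLt j))) -
      f i t (fun j => clamp (β t) (w (Fin.castLE i.isLt j)))| ≤ c * dist z w := by
    refine ((hc t ht).lipschitz i _ _ (norm_clamp_le (hβ t) _) (norm_clamp_le (hβ t) _)).trans ?_
    gcongr
    exact (pi_norm_le_iff_of_nonneg dist_nonneg).2 fun j =>
      (abs_clamp_sub_clamp_le (hβ t) _ _).trans (hzw _)
  have h2 : ∀ hi : (i : ℕ) < n,
      |a ⟨i, hi⟩ t (clamp (β t) y) * clampPow (β t) (m ⟨i, hi⟩) (z (Fin.succ ⟨i, hi⟩)) -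
        a ⟨i, hi⟩ t (clamp (β t) y) * clampPow (β t) (m ⟨i, hi⟩) (w (Fin.succ ⟨i, hi⟩))| ≤
      c * dist z w := by
    intro hi
    rw [← mul_sub, abs_mul]
    calc _ ≤ |a ⟨i, hi⟩ t (clamp (β t) y)| *
          ((m ⟨i, hi⟩ * β t ^ (m ⟨i, hi⟩ - 1) + 1) * dist z w) := by
          refine mul_le_mul_of_nonneg_left ((abs_clampPow_sub_le (hβ t) _ _ _).trans ?_)
            (abs_nonneg _)
          have := hβ t
          exact mul_le_mul_of_nonneg_left (hzw _) (by positivity)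
      _ ≤ c * dist z w := by
          rw [← mul_assoc]
          exact mul_le_mul_of_nonneg_right ((hc t ht).upper _ _ (abs_clamp_le (hβ t) _))
            dist_nonneg
  have h3 : |L i t * (y - z 0) - L i t * (y - w 0)| ≤ c * dist z w := by
    rw [← mul_sub, abs_mul]
    refine mul_le_mul (hL i i.is_le t ht) ?_ (abs_nonneg _) hc0
    rw [sub_sub_sub_cancel_left, abs_sub_comm]
    exact hzw 0
  rw [Real.dist_eq, Real.coe_toNNReal _ (by positivity)]
  by_cases hi : (i : ℕ) < n
  · have h2 := h2 hi
    simp only [hi, dif_pos]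
    rw [abs_le] at *
    constructor <;> linarith [h1.1, h1.2, h2.1, h2.2, h3.1, h3.2]
  · simp only [hi, dif_neg, not_false_eq_true]
    have := mul_nonneg hc0 (dist_nonneg (x := z) (y := w))
    rw [abs_le] at *
    constructor <;> linarith [h1.1, h1.2, h3.1, h3.2]

/-- A nonvanishing continuous function on the connected set `[0, ∞) × ℝ` keeps its sign, so the
gains can use constant signs. -/
theorem exists_sign_mul_eq_abs {a : ℝ → ℝ → ℝ}
    (ha : ContinuousOn (fun p : ℝ × ℝ => a p.1 p.2) (Ici 0 ×ˢ univ))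
    (hpos : ∀ t : ℝ, 0 ≤ t → ∀ y : ℝ, 0 < |a t y|) :
    ∃ σ : ℝ, |σ| = 1 ∧ ∀ t, 0 ≤ t → ∀ y, σ * a t y = |a t y| := by
  have hconn : IsPreconnected (Ici (0 : ℝ) ×ˢ (univ : Set ℝ)) :=
    isPreconnected_Ici.prod isPreconnected_univ
  have hne : ∀ t, 0 ≤ t → ∀ y, a t y ≠ 0 := fun t ht y => abs_pos.1 (hpos t ht y)
  have key : ∀ p ∈ Ici (0 : ℝ) ×ˢ (univ : Set ℝ), ∀ q ∈ Ici (0 : ℝ) ×ˢ (univ : Set ℝ),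
      a p.1 p.2 < 0 → ¬ 0 < a q.1 q.2 := by
    intro p hp q hq h1 h2
    obtain ⟨r, hr, hr0⟩ := hconn.intermediate_value hp hq ha ⟨h1.le, h2.le⟩
    exact hne _ hr.1 _ hr0
  rcases (hne 0 le_rfl 0).lt_or_gt with h | h
  · refine ⟨-1, by simp, fun t ht y => ?_⟩
    have := key (0, 0) ⟨self_mem_Ici, trivial⟩ (t, y) ⟨ht, trivial⟩ h
    rw [abs_of_nonpos (not_lt.1 this)]; ring
  · refine ⟨1, by simp, fun t ht y => ?_⟩
    have : ¬ a t y < 0 := fun h' => key (t, y) ⟨ht, trivial⟩ (0, 0) ⟨self_mem_Ici, trivial⟩ h' h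
    rw [abs_of_nonneg (not_lt.1 this)]; ring

/-- A solution of `V' ≤ -V + 1 / (t + 2)` tends to zero, uniformly in terms of its initial
value. -/
theorem le_of_deriv_le_neg_add {V V' : ℝ → ℝ} {s : ℝ} (hs : 0 ≤ s)
    (hV : ∀ t ∈ Ici s, HasDerivWithinAt V (V' t) (Ici s) t)
    (hV' : ∀ t ∈ Ici s, V' t ≤ -V t + 1 / (t + 2)) {t : ℝ} (ht : s ≤ t) :
    V t ≤ 2 / (t + 2) + Real.exp (-(t - s)) * V s := by
  -- For `t ≥ 0`, `2 / (t + 2)` is a supersolution of `V' = -V + 1 / (t + 2)`, so the excess over it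
  -- decays like `exp (-t)`.
  let U : ℝ → ℝ := fun t => Real.exp t * (V t - 2 / (t + 2))
  have hU : ∀ t ∈ Ici s, HasDerivWithinAt U
      (Real.exp t * (V t - 2 / (t + 2)) + Real.exp t * (V' t + 2 / (t + 2) ^ 2)) (Ici s) t := by
    intro t ht
    have hts : s ≤ t := ht
    have h2 : t + 2 ≠ 0 := by linarith
    refine (Real.hasDerivAt_exp t).hasDerivWithinAt.fun_mul ?_
    refine ((hV t ht).fun_sub (((hasDerivAt_const t (2 : ℝ)).fun_div
      ((hasDerivAt_id' t).add_const 2) h2).hasDerivWithinAt)).congr_deriv ?_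
    simp [neg_div]
  have hanti : AntitoneOn U (Ici s) := by
    refine antitoneOn_of_hasDerivWithinAt_nonpos (convex_Ici s)
      (fun t ht => (hU t ht).continuousWithinAt)
      (fun t ht => (hU t (interior_subset ht)).mono interior_subset) fun t ht => ?_
    have hts : s ≤ t := interior_subset ht
    have h1 := hV' t hts
    have h2 : 2 / (t + 2) ^ 2 ≤ 1 / (t + 2) := by
      rw [div_le_div_iff₀ (by nlinarith) (by linarith)]; nlinarith
    have h3 : 2 / (t + 2) = 2 * (1 / (t + 2)) := by ring
    rw [← mul_add]
    refine mul_nonpos_of_nonneg_of_nonpos (Real.exp_pos t).le ?_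
    rw [h3]; linarith
  have h1 : Real.exp t * (V t - 2 / (t + 2)) ≤ Real.exp s * (V s - 2 / (s + 2)) :=
    hanti self_mem_Ici ht ht
  have h2 : V t - 2 / (t + 2) ≤ Real.exp (-(t - s)) * (V s - 2 / (s + 2)) := by
    rw [show -(t - s) = s - t by ring, Real.exp_sub, div_mul_eq_mul_div,
      le_div_iff₀ (Real.exp_pos t)]
    linarith
  have h3 : 0 ≤ Real.exp (-(t - s)) * (2 / (s + 2)) := by positivity
  linarith

theorem contDiffOn_triangularField {f : (i : Fin (n + 1)) → ℝ → (Fin (i + 1) → ℝ) → ℝ}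
    {a : Fin n → ℝ → ℝ → ℝ} {m : Fin n → ℕ}
    (hf : ∀ i : Fin (n + 1),
      ContDiffOn ℝ 1 (fun p : ℝ × (Fin (i + 1) → ℝ) => f i p.1 p.2) (Ici 0 ×ˢ univ))
    (ha : ∀ i : Fin n, ContDiffOn ℝ 1 (fun p : ℝ × ℝ => a i p.1 p.2) (Ici 0 ×ˢ univ)) :
    ContDiffOn ℝ 1 (fun p : ℝ × EuclideanSpace ℝ (Fin (n + 1)) => triangularField f a m p.1 p.2)
      (Ici 0 ×ˢ univ) := by
  refine contDiffOn_euclidean.2 fun i => ?_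
  have hx : ∀ j : Fin (n + 1),
      ContDiff ℝ 1 fun p : ℝ × EuclideanSpace ℝ (Fin (n + 1)) => p.2 j := fun j =>
    (EuclideanSpace.proj (𝕜 := ℝ) j).contDiff.comp contDiff_snd
  refine ContDiffOn.add ?_ ?_
  · exact (hf i).comp (f := fun p : ℝ × EuclideanSpace ℝ (Fin (n + 1)) =>
      (p.1, fun j => p.2 (Fin.castLE i.isLt j)))
      (contDiff_fst.prodMk (contDiff_pi.2 fun j => hx _)).contDiffOn fun p hp => ⟨hp.1, trivial⟩
  · by_cases hi : (i : ℕ) < n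
    · simp only [hi, dif_pos]
      refine ContDiffOn.mul ?_ ((hx _).pow _).contDiffOn
      exact (ha ⟨i, hi⟩).comp (f := fun p : ℝ × EuclideanSpace ℝ (Fin (n + 1)) => (p.1, p.2 0))
        (contDiff_fst.prodMk (hx 0)).contDiffOn fun p hp => ⟨hp.1, trivial⟩
    · simp only [hi, dif_neg, not_false_eq_true]
      exact contDiffOn_const

theorem ForwardComplete.exists_bound_triangularField
    {f : (i : Fin (n + 1)) → ℝ → (Fin (i + 1) → ℝ) → ℝ}
    {a : Fin n → ℝ → ℝ → ℝ} {m : Fin n → ℕ}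
    (hf : ∀ i : Fin (n + 1),
      ContDiffOn ℝ 1 (fun p : ℝ × (Fin (i + 1) → ℝ) => f i p.1 p.2) (Ici 0 ×ˢ univ))
    (ha : ∀ i : Fin n, ContDiffOn ℝ 1 (fun p : ℝ × ℝ => a i p.1 p.2) (Ici 0 ×ˢ univ))
    (hcomplete : ForwardComplete (triangularField f a m)) {t₀ : ℝ} (ht₀ : 0 ≤ t₀) (R T : ℝ) :
    ∃ B : ℝ, ∀ x, IsIntegralCurveOn x (triangularField f a m) (Ici t₀) → ‖x t₀‖ ≤ R →
      ∀ t ∈ Icc t₀ T, ‖x t‖ ≤ B := by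
  obtain ⟨B, hB⟩ := hcomplete.exists_bound (fun T r => by
    obtain ⟨K, hK⟩ := ((contDiffOn_triangularField hf ha).mono (s := Ici 0 ×ˢ univ)
      (prod_mono (Icc_subset_Ici_self : Icc 0 T ⊆ Ici 0) (subset_univ (Metric.closedBall 0 r))))
      |>.exists_lipschitzOnWith one_ne_zero ((convex_Icc _ _).prod (convex_closedBall _ _))
        (isCompact_Icc.prod (isCompact_closedBall _ _))
    refine ⟨K, fun t ht => LipschitzOnWith.of_dist_le_mul fun u hu v hv => ?_⟩
    have := hK.dist_le_mul (t, u) ⟨ht, hu⟩ (t, v) ⟨ht, hv⟩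
    rwa [Prod.dist_eq (x := (t, u)), dist_self, max_eq_right dist_nonneg] at this) ht₀
    (isCompact_closedBall 0 R) T
  exact ⟨B, fun x hx hx0 => hB x hx (mem_closedBall_zero_iff.2 hx0)⟩

/-- An observer that starts from the origin at time `s` estimates all solutions starting in a
given ball, with a uniform rate. -/
theorem exists_observer {f : (i : Fin (n + 1)) → ℝ → (Fin (i + 1) → ℝ) → ℝ}
    {a : Fin n → ℝ → ℝ → ℝ} {m : Fin n → ℕ} (hm : ∀ i, Odd (m i))
    (hf : ∀ i : Fin (n + 1),
      ContDiffOn ℝ 1 (fun p : ℝ × (Fin (i + 1) → ℝ) => f i p.1 p.2) (Ici 0 ×ˢ univ))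
    (ha : ∀ i : Fin n, ContDiffOn ℝ 1 (fun p : ℝ × ℝ => a i p.1 p.2) (Ici 0 ×ˢ univ))
    (hcomplete : ForwardComplete (triangularField f a m))
    (hpos : ∀ (i : Fin n) (t : ℝ), 0 ≤ t → ∀ y : ℝ, 0 < |a i t y|)
    {s : ℝ} (hs : 0 ≤ s) (R : ℝ) :
    ∃ G : ℝ → EuclideanSpace ℝ (Fin (n + 1)) → ℝ → EuclideanSpace ℝ (Fin (n + 1)),
      ContinuousOn (fun p : ℝ × EuclideanSpace ℝ (Fin (n + 1)) × ℝ => G p.1 p.2.1 p.2.2)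
        (Ici s ×ˢ univ) ∧
      (∀ y : ℝ → ℝ, ContinuousOn y (Ici s) → ∀ z₀,
        ∃ z, IsTrajectory (fun t w => G t w (y t)) (Ici s) s z₀ z) ∧
      ∃ C : ℝ, ∀ x z, IsIntegralCurveOn x (triangularField f a m) (Ici s) → ‖x s‖ ≤ R →
        IsIntegralCurveOn z (fun t w => G t w (x t 0)) (Ici s) → z s = 0 →
        ∀ t, s ≤ t → ‖x t - z t‖ ^ 2 ≤ 4 * (2 / (t + 2) + Real.exp (-(t - s)) * C) := by
  -- Of this scale only continuity, `β ≥ 1` and the domination of the solutions matter.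
  obtain ⟨β, β', hβd, -, hβ1, hβx⟩ := exists_scale
    (P := fun t c => ∀ x, IsIntegralCurveOn x (triangularField f a m) (Ici s) → ‖x s‖ ≤ R →
      s ≤ t → ‖x t‖ ≤ c) (fun t c c' h hc x hx hxs ht => (h x hx hxs ht).trans hc) (fun T => by
      obtain ⟨B, hB⟩ := hcomplete.exists_bound_triangularField hf ha hs R T
      exact ⟨B, fun t ht x hx hxs hst => hB x hx hxs t ⟨hst, ht.2⟩⟩)
  have hβc : Continuous β := continuous_iff_continuousAt.2 fun t => (hβd t).continuousAt
  have hβ0 : ∀ t, 0 ≤ β t := fun t => zero_le_one.trans (hβ1 t)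
  let m' : ℕ → ℕ := fun i => if hi : i < n then m ⟨i, hi⟩ else 1
  have hm' : ∀ j : Fin n, m' j = m j := fun j => by simp [m', j.2]
  obtain ⟨g⟩ := GainExponents.nonempty n m'
  have haC := fun i => (ha i).continuousOn
  obtain ⟨θ, θ', hθd, hθ', hθ1, hθP⟩ := exists_scale
    (P := fun t c => ScaleDominates f a m (β t) t c ∧ t + 2 ≤ c ∧ 22 * ((n : ℝ) + 1) ≤ c ∧
      (g.b 0 : ℝ) ≤ c)
    (fun t c c' h hc => ⟨h.1.mono hc, h.2.1.trans hc, h.2.2.1.trans hc, h.2.2.2.trans hc⟩)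
    (fun T => by
      obtain ⟨c, hc⟩ := exists_scaleDominates hf haC hpos hβc hβ0 T
      refine ⟨max c (max (T + 2) (max (22 * ((n : ℝ) + 1)) (g.b 0))), fun t ht =>
        ⟨(hc t ht).mono (le_max_left _ _), ?_, ?_, ?_⟩⟩
      · have := ht.2
        exact le_trans (by linarith) ((le_max_left _ _).trans (le_max_right _ _))
      · exact (le_max_left _ _).trans ((le_max_right _ _).trans (le_max_right _ _))
      · exact (le_max_right _ _).trans ((le_max_right _ _).trans (le_max_right _ _)))
  have hθc : Continuous θ := continuous_iff_continuousAt.2 fun t => (hθd t).continuousAt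
  choose σ₀ hσ₀ hσa using fun i => exists_sign_mul_eq_abs (haC i) (hpos i)
  let σ : ℕ → ℝ := fun i => if hi : i < n then σ₀ ⟨i, hi⟩ else 1
  have hσ : ∀ i, |σ i| = 1 := fun i => by
    by_cases hi : i < n
    · simp [σ, hi, hσ₀]
    · simp [σ, hi]
  have hσj : ∀ j : Fin n, σ j = σ₀ j := fun j => by simp [σ, j.2]
  let L : ℕ → ℝ → ℝ := fun i t => g.gain (θ t) σ i
  have hL : ∀ i, Continuous (L i) := fun i => by
    simp only [L, GainExponents.gain]; fun_prop
  have hG := continuousOn_observerField (fun i => (hf i).continuousOn) haC hβc hL (m := m)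
  have hsub : Ici s ⊆ Ici (0 : ℝ) := Ici_subset_Ici.2 hs
  refine ⟨observerField f a m β L, hG.mono (prod_mono hsub le_rfl), fun y hy z₀ => ?_, ?_⟩
  · refine exists_isTrajectory_Ici_of_lipschitz (fun z => ?_) (fun T => ?_) z₀
    · exact hG.comp (f := fun t => (t, z, y t))
        (continuousOn_id.prodMk (continuousOn_const.prodMk hy)) fun t ht => ⟨hsub ht, trivial⟩
    · obtain ⟨c₁, hc₁⟩ := isCompact_Icc.exists_bound_of_continuousOn (s := Icc s T)
        hθc.continuousOn
      choose c₂ hc₂ using fun i => isCompact_Icc.exists_bound_of_continuousOn (s := Icc s T)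
        (hL i).continuousOn
      obtain ⟨c₃, hc₃⟩ := ((finite_Iic n).image c₂).bddAbove
      obtain ⟨K, hK⟩ := exists_lipschitzWith_observerField (f := f) (a := a) (m := m) hβ0 (L := L)
        (S := Icc s T) (c := max c₁ c₃)
        (fun t ht => (hθP t (hs.trans ht.1)).1.mono
          ((le_abs_self _).trans ((hc₁ t ht).trans (le_max_left _ _))))
        (fun i hi t ht => (hc₂ i t ht).trans ((hc₃ ⟨i, hi, rfl⟩).trans (le_max_right _ _)))
      exact ⟨K, fun t ht => hK t ht (y t)⟩
  have hlyapc : Continuous fun e : Fin (n + 1) → ℝ => g.lyap (θ s) σ e := by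
    unfold GainExponents.lyap; fun_prop
  -- Since `z s = 0`, the initial error is `x s`, bounded by `β s`; hence one `C` serves the whole
  -- ball.
  obtain ⟨C, hC⟩ := (isCompact_closedBall (0 : Fin (n + 1) → ℝ) (β s)).exists_bound_of_continuousOn
    hlyapc.continuousOn
  refine ⟨C, fun x z hx hxs hz hzs => ?_⟩
  have hxβ : ∀ t, s ≤ t → ∀ i, |x t i| ≤ β t := fun t ht i =>
    (PiLp.norm_apply_le (x t) i).trans (hβx t (hs.trans ht) x hx hxs ht)
  have hclamp : ∀ t, s ≤ t → ∀ i, clamp (β t) (x t i) = x t i := fun t ht i =>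
    clamp_of_abs_le (hxβ t ht i)
  let e : ℝ → Fin (n + 1) → ℝ := fun t i => x t i - z t i
  let F : ℝ → Fin (n + 1) → ℝ := fun t i => f i t (fun j => x t (Fin.castLE i.isLt j)) -
    f i t (fun j => clamp (β t) (z t (Fin.castLE i.isLt j)))
  let H : ℝ → Fin (n + 1) → ℝ := fun t i => if hi : (i : ℕ) < n then
    a ⟨i, hi⟩ t (x t 0) * (clampPow (β t) (m ⟨i, hi⟩) (x t (Fin.succ ⟨i, hi⟩)) -
      clampPow (β t) (m ⟨i, hi⟩) (z t (Fin.succ ⟨i, hi⟩))) else 0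
  have hH : ∀ t (j : Fin n), H t j.castSucc = a j t (x t 0) *
      (clampPow (β t) (m j) (x t j.succ) - clampPow (β t) (m j) (z t j.succ)) := fun t j => by
    simp only [H, Fin.val_castSucc, j.2, dif_pos]
  have he : ∀ t, s ≤ t → ∀ i, HasDerivWithinAt (fun t => e t i)
      (F t i + H t i - g.gain (θ t) σ i * e t 0) (Ici s) t := by
    intro t ht i
    have hx1 := ((EuclideanSpace.proj (𝕜 := ℝ) i).hasFDerivAt.comp_hasDerivWithinAt t (hx t ht))
    have hz1 := ((EuclideanSpace.proj (𝕜 := ℝ) i).hasFDerivAt.comp_hasDerivWithinAt t (hz t ht))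
    refine (hx1.sub hz1).congr_deriv ?_
    simp only [PiLp.proj_apply, triangularField, observerField, hclamp t ht, F, H, e, L]
    by_cases hi : (i : ℕ) < n
    · simp only [hi, dif_pos, clampPow_of_abs_le (hxβ t ht _)]; ring
    · simp only [hi, dif_neg, not_false_eq_true]; ring
  have hdiss : ∀ t ∈ Ici s, g.lyapDeriv (θ t) (θ' t) σ (e t)
      (fun i => F t i + H t i - g.gain (θ t) σ i * e t 0) ≤ -g.lyap (θ t) σ (e t) + 1 / (t + 2) := by
    intro t ht
    have ht0 : 0 ≤ t := hs.trans ht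
    obtain ⟨hdom, hθt, hθn, hθb⟩ := hθP t ht0
    have hθ0 : 0 ≤ θ t := by linarith
    refine (g.lyapDeriv_le hθn (hθ' t) hθb hσ (fun i M hM => ?_) (fun j => ?_) ?_ fun j => ?_).trans
      ?_
    · have hM0 : 0 ≤ M := (abs_nonneg _).trans (hM i le_rfl)
      refine (hdom.lipschitz i _ _ ((pi_norm_le_iff_of_nonneg (hβ0 t)).2 fun j => hxβ t ht _)
        (norm_clamp_le (hβ0 t) _)).trans ?_
      gcongr
      refine (pi_norm_le_iff_of_nonneg hM0).2 fun j => ?_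
      have h1 := abs_clamp_sub_clamp_le (hβ0 t) (x t (Fin.castLE i.isLt j))
        (z t (Fin.castLE i.isLt j))
      rw [hclamp t ht] at h1
      exact h1.trans (hM _ (Fin.le_def.2 (Nat.lt_succ_iff.1 j.2)))
    · rw [hH, abs_mul]
      refine (mul_le_mul_of_nonneg_left (abs_clampPow_sub_le (hβ0 t) _ _ _) (abs_nonneg _)).trans ?_
      rw [← mul_assoc]
      exact mul_le_mul_of_nonneg_right (hdom.upper _ _ (hxβ t ht 0)) (abs_nonneg _)
    · simp [H]
    · rw [hH]
      exact coercive_superdiagonal (hθ1 t) (hβ0 t) (hm j) (by rw [← hm']; exact g.k_eq j j.2)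
        (by rw [hσj]; exact hσa j t ht0 _) (hdom.lower _ _ (hxβ t ht 0)) _ _
    · rw [← one_div]
      gcongr
  intro t ht
  have hV := le_of_deriv_le_neg_add hs (V := fun t => g.lyap (θ t) σ (e t))
    (fun t ht => g.hasDerivWithinAt_lyap (hθd t).hasDerivWithinAt (he t ht)) hdiss ht
  have hn : (0 : ℝ) ≤ n := Nat.cast_nonneg n
  have hθ4 : 4 ≤ θ t := by
    have := (hθP t (hs.trans ht)).2.2.1
    linarith
  have h1 := g.sum_sq_le_lyap hθ4 hσ (e t)
  have h2 : ‖x t - z t‖ ^ 2 = ∑ i, e t i ^ 2 := by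
    rw [EuclideanSpace.norm_sq_eq]
    simp [e]
  have h3 : g.lyap (θ s) σ (e s) ≤ C := by
    refine (le_abs_self _).trans (hC _ ?_)
    rw [mem_closedBall_zero_iff, pi_norm_le_iff_of_nonneg (hβ0 s)]
    intro i
    simpa [e, hzs] using hxβ s le_rfl i
  rw [h2]
  refine h1.trans ?_
  have h4 := mul_le_mul_of_nonneg_left h3 (Real.exp_pos (-(t - s))).le
  linarith

theorem tendsto_observer_rate (C s : ℝ) :
    Tendsto (fun t : ℝ => √(4 * (2 / (t + 2) + Real.exp (-(t - s)) * C))) atTop (𝓝 0) := by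
  have h1 : Tendsto (fun t : ℝ => 2 / (t + 2)) atTop (𝓝 0) :=
    tendsto_const_nhds.div_atTop (tendsto_atTop_add_const_right _ _ tendsto_id)
  have h2 : Tendsto (fun t : ℝ => Real.exp (-(t - s)) * C) atTop (𝓝 (0 * C)) :=
    (Real.tendsto_exp_neg_atTop_nhds_zero.comp
      (tendsto_atTop_add_const_right _ (-s) tendsto_id)).mul_const C
  have := ((h1.add h2).const_mul 4).sqrt
  simpa using this

/-! ### Observers on balls and switching observers -/

theorem odpSolvable_triangularField {f : (i : Fin (n + 1)) → ℝ → (Fin (i + 1) → ℝ) → ℝ}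
    {a : Fin n → ℝ → ℝ → ℝ} {m : Fin n → ℕ} (hm : ∀ i, Odd (m i))
    (hf : ∀ i : Fin (n + 1),
      ContDiffOn ℝ 1 (fun p : ℝ × (Fin (i + 1) → ℝ) => f i p.1 p.2) (Ici 0 ×ˢ univ))
    (ha : ∀ i : Fin n, ContDiffOn ℝ 1 (fun p : ℝ × ℝ => a i p.1 p.2) (Ici 0 ×ˢ univ))
    (hcomplete : ForwardComplete (triangularField f a m))
    (hpos : ∀ (i : Fin n) (t : ℝ), 0 ≤ t → ∀ y : ℝ, 0 < |a i t y|) (R : ℝ) :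
    ODPSolvable (triangularField f a m)
      (fun _ (x : EuclideanSpace ℝ (Fin (n + 1))) => x 0) (Metric.closedBall 0 R) := by
  intro t₀ ht₀
  obtain ⟨G, hG, hex, C, hC⟩ := exists_observer hm hf ha hcomplete hpos ht₀ R
  refine ⟨G, {0}, hG, singleton_nonempty 0, fun x hx hx0 z₀ hz₀ => ?_⟩
  rw [mem_singleton_iff] at hz₀
  subst hz₀
  obtain ⟨z, hz⟩ := hex (fun t => x t 0) ((EuclideanSpace.proj (𝕜 := ℝ) 0).continuous.comp_continuousOn
    hx.continuousOn) 0
  refine ⟨z, hz, ?_⟩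
  refine squeeze_zero_norm' ?_ (tendsto_observer_rate C t₀)
  filter_upwards [eventually_ge_atTop t₀] with t ht
  exact Real.le_sqrt_of_sq_le (hC x z hx (mem_closedBall_zero_iff.1 hx0) hz.1 hz.2.1 t ht)

theorem sodpSolvable_triangularField {f : (i : Fin (n + 1)) → ℝ → (Fin (i + 1) → ℝ) → ℝ}
    {a : Fin n → ℝ → ℝ → ℝ} {m : Fin n → ℕ} (hm : ∀ i, Odd (m i))
    (hf : ∀ i : Fin (n + 1),
      ContDiffOn ℝ 1 (fun p : ℝ × (Fin (i + 1) → ℝ) => f i p.1 p.2) (Ici 0 ×ˢ univ))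
    (ha : ∀ i : Fin n, ContDiffOn ℝ 1 (fun p : ℝ × ℝ => a i p.1 p.2) (Ici 0 ×ˢ univ))
    (hcomplete : ForwardComplete (triangularField f a m))
    (hpos : ∀ (i : Fin n) (t : ℝ), 0 ≤ t → ∀ y : ℝ, 0 < |a i t y|) :
    SODPSolvable (triangularField f a m)
      (fun _ (x : EuclideanSpace ℝ (Fin (n + 1))) => x 0) univ := by
  intro t₀ ht₀
  -- Observer `k`, started at `s`, serves the ball of radius `k` at time `t₀`, whose solutions are
  -- still bounded at `s`; `N` is a time after which its error is at most `1 / (k + 1)`.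
  have hobs : ∀ (k : ℕ) (s : ℝ), ∃ (G : ℝ → EuclideanSpace ℝ (Fin (n + 1)) → ℝ →
      EuclideanSpace ℝ (Fin (n + 1))) (N : ℝ), t₀ ≤ s →
      ContinuousOn (fun p : ℝ × EuclideanSpace ℝ (Fin (n + 1)) × ℝ => G p.1 p.2.1 p.2.2)
        (Ici s ×ˢ univ) ∧
      (∀ y : ℝ → ℝ, ContinuousOn y (Ici s) → ∀ z₀,
        ∃ z, IsTrajectory (fun t w => G t w (y t)) (Ici s) s z₀ z) ∧
      ∀ x z, IsIntegralCurveOn x (triangularField f a m) (Ici t₀) → ‖x t₀‖ ≤ k →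
        IsIntegralCurveOn z (fun t w => G t w (x t 0)) (Ici s) → z s = 0 →
        ∀ t, s ≤ t → N ≤ t → ‖x t - z t‖ ≤ 1 / (k + 1) := by
    intro k s
    by_cases hs : t₀ ≤ s
    swap
    · exact ⟨fun _ _ _ => 0, 0, fun h => absurd h hs⟩
    obtain ⟨B, hB⟩ := hcomplete.exists_bound_triangularField hf ha ht₀ k s
    obtain ⟨G, hG, hex, C, hC⟩ := exists_observer hm hf ha hcomplete hpos (ht₀.trans hs) B
    have hk : (0 : ℝ) < 1 / (k + 1) := by positivity
    obtain ⟨N, hN⟩ := eventually_atTop.1 ((tendsto_observer_rate C s).eventually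
      (eventually_le_nhds hk))
    refine ⟨G, N, fun _ => ⟨hG, hex, fun x z hx hx0 hz hzs t hst hNt => ?_⟩⟩
    exact (Real.le_sqrt_of_sq_le (hC x z (hx.mono (Ici_subset_Ici.2 hs))
      (hB x hx hx0 s ⟨hs, le_rfl⟩) hz hzs t hst)).trans (hN t hNt)
  choose G N hobs using hobs
  let ρ : ℕ → ℝ := fun k => Nat.rec t₀ (fun k r => max (r + 1) (N (k + 2) r)) k
  have hρ0 : ρ 0 = t₀ := rfl
  have hρs : ∀ k, ρ (k + 1) = max (ρ k + 1) (N (k + 2) (ρ k)) := fun k => rfl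
  clear_value ρ
  have hρ1 : ∀ k, ρ k + 1 ≤ ρ (k + 1) := fun k => (hρs k).symm ▸ le_max_left _ _
  have hρmono : StrictMono ρ := strictMono_nat_of_lt_succ fun k => by linarith [hρ1 k]
  have hρk : ∀ k : ℕ, t₀ + k ≤ ρ k := by
    intro k
    induction k with
    | zero => simp [hρ0]
    | succ k ih => push_cast; linarith [hρ1 k]
  have hρt : ∀ k, t₀ ≤ ρ k := fun k => hρ0 ▸ hρmono.monotone (Nat.zero_le k)
  have hρtop : Tendsto ρ atTop atTop :=
    tendsto_atTop_mono hρk (tendsto_atTop_add_const_left _ _ tendsto_natCast_atTop_atTop)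
  -- Truncated subtraction yields the repeated initial time `τ 0 = τ 1 = t₀`.
  refine ⟨fun k => ρ (k - 1), fun k => G k (ρ (k - 1 - 1)), {0}, hρ0, hρ0, ?_,
    hρtop.comp (tendsto_sub_atTop_nat 1), fun k hk => ?_, singleton_nonempty 0,
    fun x hx _ ζ hζ => ?_⟩
  · intro i hi j hj hij
    simp only [mem_Ici] at hi hj
    exact hρmono (by omega)
  · exact (hobs k _ (hρt _)).1.mono (prod_mono Icc_subset_Ici_self le_rfl)
  have hy : ∀ k, ContinuousOn (fun t => x t 0) (Ici (ρ k)) := fun k =>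
    (EuclideanSpace.proj (𝕜 := ℝ) 0).continuous.comp_continuousOn
      (hx.continuousOn.mono (Ici_subset_Ici.2 (hρt k)))
  choose z hz using fun k => (hobs k _ (hρt (k - 1 - 1))).2.1 (fun t => x t 0) (hy _) (ζ k)
  have hζ0 : ∀ k, ζ k = 0 := hζ
  let κ : ℝ → ℕ := fun t => Classical.epsilon fun k => t ∈ Ico (ρ k) (ρ (k + 1))
  let Z : ℝ → EuclideanSpace ℝ (Fin (n + 1)) := fun t => z (κ t + 1) t
  have hZ : ∀ k : ℕ, EqOn Z (z (k + 1)) (Ico (ρ k) (ρ (k + 1))) := by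
    intro k t ht
    have h1 : t ∈ Ico (ρ (κ t)) (ρ (κ t + 1)) :=
      Classical.epsilon_spec (p := fun k => t ∈ Ico (ρ k) (ρ (k + 1))) ⟨k, ht⟩
    have h2 : κ t = k := by
      have h3 := hρmono.lt_iff_lt.1 (h1.1.trans_lt ht.2)
      have h4 := hρmono.lt_iff_lt.1 (ht.1.trans_lt h1.2)
      omega
    simp only [Z, h2]
  refine ⟨z, Z, fun k hk => (hz k).mono_Icc, fun k hk => ?_, ?_⟩
  · obtain ⟨k, rfl⟩ := Nat.exists_eq_add_of_le' hk
    exact hZ k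
  rw [tendsto_zero_iff_norm_tendsto_zero, Metric.tendsto_atTop]
  intro ε hε
  obtain ⟨k₁, hk₁⟩ := exists_nat_one_div_lt hε
  -- From index `k₂` on, the design ball contains the initial state; `k₁` takes care of the accuracy
  -- `ε`.
  obtain ⟨k₂, hk₂⟩ := exists_nat_ge ‖x t₀‖
  set k₀ := max k₁ k₂
  refine ⟨ρ (k₀ + 1), fun t ht => ?_⟩
  obtain ⟨j, hj, hj'⟩ : ∃ j, ρ j ≤ t ∧ t < ρ (j + 1) := by
    have hex : ∃ j, t < ρ (j + 1) :=
      ((hρtop.comp (tendsto_add_atTop_nat 1)).eventually (eventually_gt_atTop t)).exists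
    refine ⟨Nat.find hex, ?_, Nat.find_spec hex⟩
    rcases hfind : Nat.find hex with _ | j
    · exact (hρmono.monotone (Nat.zero_le _)).trans ht
    · exact not_lt.1 (Nat.find_min hex (by omega))
  have hk₀j : k₀ + 1 ≤ j := by
    have := hρmono.lt_iff_lt.1 (ht.trans_lt hj')
    omega
  -- The interval number `j` is positive, which excludes observer `1`, the only one without a
  -- warm-up.
  obtain ⟨i, rfl⟩ : ∃ i, j = i + 1 := ⟨j - 1, by omega⟩
  have hNi : N (i + 2) (ρ i) ≤ t := ((hρs i).symm ▸ le_max_right _ _ : _ ≤ ρ (i + 1)).trans hj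
  have hxi : ‖x t₀‖ ≤ ((i + 2 : ℕ) : ℝ) := hk₂.trans (by
    exact_mod_cast (le_max_right k₁ k₂).trans (by omega))
  have h1 := (hobs (i + 2) (ρ i) (hρt i)).2.2 x (z (i + 2)) hx hxi (hz (i + 2)).1
    ((hz (i + 2)).2.1.trans (hζ0 _)) t ((hρmono.monotone (Nat.le_succ i)).trans hj) hNi
  rw [dist_zero_right, norm_norm, hZ (i + 1) ⟨hj, hj'⟩]
  refine h1.trans_lt (lt_of_le_of_lt ?_ hk₁)
  have : k₁ ≤ i + 2 := (le_max_left k₁ k₂).trans (by omega)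
  gcongr

end Observer

theorem theorem1p1 (n : ℕ)
    (f : (i : Fin (n + 1)) → ℝ → (Fin (i + 1) → ℝ) → ℝ)
    (a : Fin n → ℝ → ℝ → ℝ) (m : Fin n → ℕ)
    (hm : ∀ i, Odd (m i))
    (hf : ∀ i : Fin (n + 1),
      ContDiffOn ℝ 1 (fun p : ℝ × (Fin (i + 1) → ℝ) => f i p.1 p.2) (Ici 0 ×ˢ univ))
    (ha : ∀ i : Fin n, ContDiffOn ℝ 1 (fun p : ℝ × ℝ => a i p.1 p.2) (Ici 0 ×ˢ univ))
    (hcomplete : ForwardComplete (triangularField f a m))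
    (hpos : ∀ (i : Fin n) (t : ℝ), 0 ≤ t → ∀ y : ℝ, 0 < |a i t y|) :
    SODPSolvable (triangularField f a m)
        (fun _ (x : EuclideanSpace ℝ (Fin (n + 1))) => x 0) univ ∧
      ∀ R : ℝ, 0 < R →
        ODPSolvable (triangularField f a m)
          (fun _ (x : EuclideanSpace ℝ (Fin (n + 1))) => x 0) (Metric.closedBall 0 R) :=
  ⟨sodpSolvable_triangularField hm hf ha hcomplete hpos,
    fun R _ => odpSolvable_triangularField hm hf ha hcomplete hpos R⟩
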